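/- Let $q$ be a prime power, let $d\ge 1$, and let $C=\{F=0\}\subset\mathbb{P}^2$ be a plane curve over the finite field $\mathbb{F}_q$ of degree $d$, where $F$ is a nonzero homogeneous polynomial of degree $d$ in three variables with coefficients in $\mathbb{F}_q$ (not assumed irreducible or reduced). Assume that $C$ has no $\mathbb{F}_q$-linear components, that is, no nonzero linear form with coefficients in $\mathbb{F}_q$ divides $F$. Let $N_q(C)$ denote the number of points of $\mathbb{P}^2(\mathbb{F}_q)$ lying on $C$. If $$N_q(C)\ \ge\ (d-2)q+3,$$ then $C$ is absolutely irreducible, that is, $F$ is irreducible as a polynomial over the algebraic closure of $\mathbb{F}_q$. -/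

import Mathlib

/-- A plane curve of degree `d` over the field `K`: the locus `{F = 0}` in the projective plane,
given by a nonzero homogeneous polynomial `F` of degree `d ≥ 1` in three variables over `K`.
Multiplicities of components are remembered, `F` need be neither irreducible nor reduced. -/
structure ProjPlaneCurve (K : Type*) [Field K] (d : ℕ) where
  /-- the defining form of the curve -/
  form : MvPolynomial (Fin 3) K
  form_ne_zero : form ≠ 0
  isHomogeneous : form.IsHomogeneous d
  degree_pos : 1 ≤ d

namespace ProjPlaneCurve

variable {K : Type*} [Field K] {d : ℕ}

/-- The set of `K`-points of the curve, as a subset of the projective plane over `K`. -/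
def points (C : ProjPlaneCurve K d) : Set (Projectivization K (Fin 3 → K)) :=
  {P | MvPolynomial.eval P.rep C.form = 0}

/-- Membership in `points` may be tested on any choice of homogeneous coordinates. -/
theorem mk_mem_points_iff (C : ProjPlaneCurve K d) (v : Fin 3 → K) (hv : v ≠ 0) :
    Projectivization.mk K v hv ∈ C.points ↔ MvPolynomial.eval v C.form = 0 := by
  obtain ⟨a, ha⟩ := Projectivization.exists_smul_eq_mk_rep K v hv
  have h : MvPolynomial.eval ((a : K) • v) C.form
      = (a : K) ^ d * MvPolynomial.eval v C.form := by
    rw [MvPolynomial.eval_eq, MvPolynomial.eval_eq, Finset.mul_sum]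
    refine Finset.sum_congr rfl fun m hm => ?_
    have hp : (a : K) ^ d = ∏ i ∈ m.support, (a : K) ^ m i := by
      rw [Finset.prod_pow_eq_pow_sum, ← C.isHomogeneous.degree_eq_sum_deg_support hm]
    rw [hp]
    simp only [Pi.smul_apply, smul_eq_mul, mul_pow, Finset.prod_mul_distrib]
    ring
  have ha' : (Projectivization.mk K v hv).rep = (a : K) • v := ha.symm
  rw [points, Set.mem_ofPred_eq, ha', h, mul_eq_zero]
  simp

/-- The number `N(C)` of `K`-points of the curve. -/
noncomputable def numPoints (C : ProjPlaneCurve K d) : ℕ :=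
  Nat.card C.points

/-- `C` has a `K`-linear component: some line defined over `K`, i.e. the zero locus of a nonzero
linear form with coefficients in `K`, is a component of `C`. -/
def HasLinearComponent (C : ProjPlaneCurve K d) : Prop :=
  ∃ L : MvPolynomial (Fin 3) K, L ≠ 0 ∧ L.IsHomogeneous 1 ∧ L ∣ C.form

/-- `C` is absolutely irreducible: its form is irreducible over the algebraic closure of `K`. -/
def AbsolutelyIrreducible (C : ProjPlaneCurve K d) : Prop :=
  Irreducible (MvPolynomial.map (algebraMap K (AlgebraicClosure K)) C.form)

end ProjPlaneCurve

/-! Write `q` for the order of `K`. The hypothesis and the count `q ^ 2 + q + 1` of points of the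
plane give `d ≤ q + 2` (`degree_le_of_le_ncard`).

Irreducibility over `K`. In a factorization `F = A * B` both degrees `a`, `b` are at least 2. If
both are below `q`, Sziklai's bound `(e - 1) * q + 1` for each factor (`ncard_ratZeros_le`) leaves
at most `(d - 2) * q + 2` points, one too few. Otherwise the degrees are `q` and `2`. An external
line of the conic has `q + 1` points, of which the curve of degree `q` covers at most `q`, so the
uncovered points block all external lines. When the conic has at least two points, a double count
over all lines shows that there are at least `q - 1` uncovered points (`ncard_union_conic_le`); a
conic with at most one point is handled directly.

Sziklai's bound for a prime form of degree `e < q`. Expand `F(x + λ x ^ q)` in `λ`, `x ^ q` being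
the coordinatewise power, and let `k` be the least index whose coefficient is not divisible by `F`.
Such a `k` exists (`exists_not_dvd_frobCoeff`) and lies strictly between `0` and `e`. This
coefficient, of degree `e + (q - 1) * k`, has contact of order at least `k + 1` with the curve at
each rational point (`aeval_chart_frobCoeff_mem`). A form of Bezout's theorem
(`mul_ncard_le_mul_of_coprime`) gives `(k + 1) * N ≤ e * (e + (q - 1) * k)`, which implies the
bound.

Absolute irreducibility. If the prime form `F` splits over the algebraic closure, the norm of each
factor is a power of `F` up to a unit, so all rational points lie on every factor
(`eval_eq_zero_of_map_eq_mul`). Take a factor of degree `g ≤ d / 2`. If `g = 1`, the rational line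
through two rational points lies on the curve. If `g ≥ 2`, some rational point is off the factor,
and the lines through it carry at most `(q + 1) * g` zeros, which is too few. -/

open MvPolynomial

open scoped LinearAlgebra.Projectivization

/-! ### Homogeneity of factors -/

/-- Multiplying every variable by a new variable sorts a polynomial by degree. -/
theorem coeff_aeval_C_X_mul_X {σ R : Type*} [CommRing R] (p : MvPolynomial σ R) (j : ℕ) :
    (aeval (fun i => Polynomial.C (X i) * Polynomial.X :
      σ → Polynomial (MvPolynomial σ R)) p).coeff j = homogeneousComponent j p := by
  classical
  induction p using MvPolynomial.induction_on' with
  | add p q ihp ihq => rw [map_add, Polynomial.coeff_add, ihp, ihq, map_add]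
  | monomial m c =>
    rw [aeval_monomial, Finsupp.prod]
    simp only [mul_pow, Finset.prod_mul_distrib]
    rw [Finset.prod_pow_eq_pow_sum]
    rw [IsScalarTower.algebraMap_apply R (MvPolynomial σ R) (Polynomial (MvPolynomial σ R)),
      Polynomial.algebraMap_apply, ← mul_assoc]
    simp only [← map_pow, ← map_prod, ← map_mul]
    have : (algebraMap R (MvPolynomial σ R)) c * ∏ x ∈ m.support, X x ^ m x = monomial m c := by
      rw [monomial_eq]; rfl
    rw [Algebra.algebraMap_self, RingHom.id_apply, this, Polynomial.coeff_C_mul_X_pow]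
    ext m'
    rw [coeff_homogeneousComponent]
    have hd : m.degree = ∑ i ∈ m.support, m i := rfl
    split_ifs with h1 h2 h2
    · rfl
    · rw [coeff_monomial, if_neg]; rintro rfl; exact h2 (by rw [hd, h1])
    · rw [coeff_monomial, if_neg, coeff_zero]; rintro rfl; exact h1 (by rw [← h2, hd])
    · rfl

/-- The factors of a nonzero homogeneous polynomial over a domain are homogeneous. -/
theorem exists_isHomogeneous_of_mul {σ R : Type*} [CommRing R] [IsDomain R]
    {p r : MvPolynomial σ R} {n : ℕ} (h : (p * r).IsHomogeneous n) (h0 : p * r ≠ 0) :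
    ∃ a b, a + b = n ∧ p.IsHomogeneous a ∧ r.IsHomogeneous b := by
  set φ : MvPolynomial σ R →ₐ[R] Polynomial (MvPolynomial σ R) :=
    aeval (fun i => Polynomial.C (X i) * Polynomial.X) with hφ
  have hinj : ∀ s, φ s = 0 → s = 0 := by
    intro s hs
    rw [← sum_homogeneousComponent s]
    refine Finset.sum_eq_zero fun i _ => ?_
    rw [← coeff_aeval_C_X_mul_X, ← hφ, hs, Polynomial.coeff_zero]
  have hp0 : φ p ≠ 0 := fun h' => h0 (by rw [hinj p h', zero_mul])
  have hr0 : φ r ≠ 0 := fun h' => h0 (by rw [hinj r h', mul_zero])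
  -- The product is a single monomial in the new variable. Degree and trailing degree are both
  -- additive, so they must agree for each factor.
  have hpr : φ p * φ r = Polynomial.C (p * r) * Polynomial.X ^ n := by
    rw [← map_mul]
    ext1 j
    rw [coeff_aeval_C_X_mul_X, Polynomial.coeff_C_mul_X_pow, homogeneousComponent_of_mem h]
  have h1 : (φ p).natDegree + (φ r).natDegree = n := by
    rw [← Polynomial.natDegree_mul hp0 hr0, hpr, Polynomial.natDegree_C_mul_X_pow _ _ h0]
  have h2 : (φ p).natTrailingDegree + (φ r).natTrailingDegree = n := by
    rw [← Polynomial.natTrailingDegree_mul hp0 hr0, hpr, Polynomial.C_mul_X_pow_eq_monomial,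
      Polynomial.natTrailingDegree_monomial h0]
  have h3 := Polynomial.natTrailingDegree_le_natDegree (φ p)
  have h4 := Polynomial.natTrailingDegree_le_natDegree (φ r)
  have key : ∀ s, (φ s).natTrailingDegree = (φ s).natDegree →
      s.IsHomogeneous (φ s).natDegree := by
    intro s hs
    have : s = homogeneousComponent (φ s).natDegree s := by
      conv_lhs => rw [← sum_homogeneousComponent s]
      have hz : ∀ i, i ≠ (φ s).natDegree → homogeneousComponent i s = 0 := by
        intro i hi
        rw [← coeff_aeval_C_X_mul_X, ← hφ]
        rcases lt_or_gt_of_ne hi with h' | h'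
        · exact Polynomial.coeff_eq_zero_of_lt_natTrailingDegree (by omega)
        · exact Polynomial.coeff_eq_zero_of_natDegree_lt h'
      by_cases hm : (φ s).natDegree ∈ Finset.range (s.totalDegree + 1)
      · exact Finset.sum_eq_single_of_mem _ hm fun i _ hi => hz i hi
      · rw [Finset.sum_eq_zero fun i hi => hz i (fun h => hm (h ▸ hi))]
        rw [homogeneousComponent_eq_zero]
        simpa using hm
    rw [this]
    convert! homogeneousComponent_isHomogeneous _ s using 2
    rw [← this]
  exact ⟨_, _, h1, key p (by omega), key r (by omega)⟩

/-! ### Restriction of a form to a line -/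

/-- The polynomial `F(w + λ u)` in `λ`. -/
noncomputable def alongLine {σ k A : Type*} [CommRing k] [CommRing A] [Algebra k A]
    (F : MvPolynomial σ k) (w u : σ → A) : Polynomial A :=
  aeval (fun i => Polynomial.C (w i) + Polynomial.X * Polynomial.C (u i)) F

theorem alongLine_map {σ k A B : Type*} [CommRing k] [CommRing A] [CommRing B] [Algebra k A]
    [Algebra k B] (f : A →ₐ[k] B) (F : MvPolynomial σ k) (w u : σ → A) :
    alongLine F (fun i => f (w i)) (fun i => f (u i)) =
      (alongLine F w u).map (f : A →+* B) := by
  have : (alongLine F w u).map (f : A →+* B) = Polynomial.mapAlgHom f (alongLine F w u) := rfl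
  rw [this, alongLine, alongLine, ← AlgHom.comp_apply]
  congr 1
  ext i
  simp

theorem eval_alongLine {σ k A : Type*} [CommRing k] [CommRing A] [Algebra k A]
    (F : MvPolynomial σ k) (w u : σ → A) (c : A) :
    (alongLine F w u).eval c = aeval (fun i => w i + c * u i) F := by
  have h : (alongLine F w u).eval c
      = ((Polynomial.aeval c : Polynomial A →ₐ[A] A).restrictScalars k) (alongLine F w u) := by
    simp [Polynomial.aeval_def, Polynomial.eval₂_eq_eval_map]
  rw [h, alongLine, ← AlgHom.comp_apply]
  congr 1
  ext i
  simp
  exact mul_comm _ _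

/-- The homogeneous expansion of a form along a line. -/
theorem aeval_add_eq_sum_and_coeff_eq_zero {σ k A : Type*} [CommRing k] [CommRing A]
    [Algebra k A] {F : MvPolynomial σ k} {e : ℕ} (hF : F.IsHomogeneous e) (w u : σ → A) (α β : A) :
    (∀ j, e < j → (alongLine F w u).coeff j = 0) ∧
      aeval (fun i => α * w i + β * u i) F =
        ∑ j ∈ Finset.range (e + 1), α ^ (e - j) * β ^ j * (alongLine F w u).coeff j := by
  classical
  unfold alongLine
  set Φ : MvPolynomial σ k →ₐ[k] Polynomial A :=
    aeval (fun i => Polynomial.C (w i) + Polynomial.X * Polynomial.C (u i)) with hΦ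
  rw [← mem_homogeneousSubmodule, ← homogeneousSubmodule_one_pow] at hF
  induction hF using Submodule.pow_induction_on_left' with
  | algebraMap r =>
    refine ⟨fun j hj => ?_, ?_⟩
    · rw [AlgHom.commutes, IsScalarTower.algebraMap_apply k A (Polynomial A),
        Polynomial.algebraMap_apply, Polynomial.coeff_C, if_neg (by omega)]
    · rw [AlgHom.commutes, AlgHom.commutes, IsScalarTower.algebraMap_apply k A (Polynomial A),
        Polynomial.algebraMap_apply]
      simp
  | add x y i _ _ hx hy =>
    refine ⟨fun j hj => ?_, ?_⟩
    · rw [map_add, Polynomial.coeff_add, hx.1 j hj, hy.1 j hj, add_zero]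
    · rw [map_add, hx.2, hy.2, ← Finset.sum_add_distrib]
      simp [mul_add]
  | mem_mul m hm i x _ hx =>
    rw [homogeneousSubmodule_one_eq_span_X] at hm
    induction hm using Submodule.span_induction with
    | mem l hl =>
      obtain ⟨t, rfl⟩ := hl
      have hc : ∀ j, (Φ (X t * x)).coeff (j + 1)
          = w t * (Φ x).coeff (j + 1) + u t * (Φ x).coeff j := by
        intro j
        rw [map_mul, hΦ, aeval_X, add_mul, Polynomial.coeff_add, Polynomial.coeff_C_mul, mul_assoc,
          Polynomial.coeff_X_mul, Polynomial.coeff_C_mul]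
      have hc0 : (Φ (X t * x)).coeff 0 = w t * (Φ x).coeff 0 := by
        rw [map_mul, hΦ, aeval_X, add_mul, Polynomial.coeff_add, Polynomial.coeff_C_mul, mul_assoc,
          Polynomial.coeff_X_mul_zero, add_zero]
      refine ⟨fun j hj => ?_, ?_⟩
      · obtain ⟨j, rfl⟩ : ∃ j', j = j' + 1 := ⟨j - 1, by omega⟩
        rw [hc, hx.1 _ (by omega), hx.1 _ (by omega)]; simp
      · rw [map_mul, aeval_X, hx.2, Nat.succ_eq_add_one, Finset.sum_range_succ' _ (i + 1)]
        simp only [hc, hc0]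
        rw [add_mul, Finset.mul_sum, Finset.mul_sum]
        have h1 : ∑ j ∈ Finset.range (i + 1), α * w t * (α ^ (i - j) * β ^ j * (Φ x).coeff j)
            = (∑ j ∈ Finset.range (i + 1), α ^ (i + 1 - (j + 1)) * β ^ (j + 1) *
              (w t * (Φ x).coeff (j + 1))) + α ^ (i + 1 - 0) * β ^ 0 * (w t * (Φ x).coeff 0) := by
          rw [← Finset.sum_range_succ' (fun j => α ^ (i + 1 - j) * β ^ j * (w t * (Φ x).coeff j)),
            Finset.sum_range_succ _ (i + 1), hx.1 (i + 1) (by omega)]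
          simp only [mul_zero, add_zero]
          refine Finset.sum_congr rfl fun j hj => ?_
          rw [show i + 1 - j = (i - j) + 1 by have := Finset.mem_range.1 hj; omega, pow_succ]
          ring
        rw [h1, add_right_comm, ← Finset.sum_add_distrib]
        congr 1
        refine Finset.sum_congr rfl fun j hj => ?_
        rw [show i + 1 - (j + 1) = i - j by omega]
        ring
    | zero => simp
    | add a b _ _ ha hb =>
      rw [add_mul]
      refine ⟨fun j hj => ?_, ?_⟩
      · rw [map_add, Polynomial.coeff_add, ha.1 j hj, hb.1 j hj, add_zero]
      · rw [map_add, ha.2, hb.2, ← Finset.sum_add_distrib]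
        simp [mul_add]
    | smul c a _ ha =>
      rw [smul_mul_assoc]
      refine ⟨fun j hj => ?_, ?_⟩
      · rw [map_smul, Polynomial.coeff_smul, ha.1 j hj, smul_zero]
      · rw [map_smul, map_smul, ha.2, Finset.smul_sum]
        simp

theorem aeval_add_eq_sum_of_isHomogeneous {σ k A : Type*} [CommRing k] [CommRing A]
    [Algebra k A] {F : MvPolynomial σ k} {e : ℕ} (hF : F.IsHomogeneous e) (w u : σ → A) (α β : A) :
    aeval (fun i => α * w i + β * u i) F =
      ∑ j ∈ Finset.range (e + 1), α ^ (e - j) * β ^ j * (alongLine F w u).coeff j :=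
  (aeval_add_eq_sum_and_coeff_eq_zero hF w u α β).2

theorem coeff_alongLine_eq_zero {σ k A : Type*} [CommRing k] [CommRing A]
    [Algebra k A] {F : MvPolynomial σ k} {e : ℕ} (hF : F.IsHomogeneous e) (w u : σ → A) {j : ℕ}
    (hj : e < j) : (alongLine F w u).coeff j = 0 :=
  (aeval_add_eq_sum_and_coeff_eq_zero hF w u 0 0).1 j hj

theorem coeff_alongLine_zero {σ k A : Type*} [CommRing k] [CommRing A] [Algebra k A]
    (F : MvPolynomial σ k) (w u : σ → A) : (alongLine F w u).coeff 0 = aeval w F := by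
  rw [Polynomial.coeff_zero_eq_eval_zero, eval_alongLine]
  simp

theorem coeff_alongLine_self {σ k A : Type*} [CommRing k] [CommRing A] [Algebra k A]
    {F : MvPolynomial σ k} {e : ℕ} (hF : F.IsHomogeneous e) (w u : σ → A) :
    (alongLine F w u).coeff e = aeval u F := by
  have h := aeval_add_eq_sum_of_isHomogeneous hF w u 0 1
  rw [Finset.sum_eq_single_of_mem e (by simp)] at h
  · simpa using h.symm
  · intro j hj hje
    rw [zero_pow (by have := Finset.mem_range.1 hj; omega)]
    simp

/-- Scaling the argument of a form. -/
theorem aeval_mul_of_isHomogeneous {σ k A : Type*} [CommRing k] [CommRing A]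
    [Algebra k A] {F : MvPolynomial σ k} {e : ℕ} (hF : F.IsHomogeneous e) (w : σ → A) (α : A) :
    aeval (fun i => α * w i) F = α ^ e * aeval w F := by
  rw [aeval_def, aeval_def, eval₂_eq, eval₂_eq, Finset.mul_sum]
  refine Finset.sum_congr rfl fun m hm => ?_
  have : α ^ e = ∏ i ∈ m.support, α ^ m i := by
    rw [Finset.prod_pow_eq_pow_sum, ← hF.degree_eq_sum_deg_support hm]
  rw [this]
  simp only [mul_pow, Finset.prod_mul_distrib]
  ring

/-- The coefficients of a form along the line through the generic point and its Frobenius image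
are forms. -/
theorem isHomogeneous_coeff_alongLine {σ k : Type*} [CommRing k]
    {F : MvPolynomial σ k} {e q : ℕ} (hq : 1 ≤ q) (hF : F.IsHomogeneous e) (j : ℕ) :
    ((alongLine F (fun i => (X i : MvPolynomial σ k)) (fun i => X i ^ q)).coeff j).IsHomogeneous
      (e + (q - 1) * j) := by
  unfold alongLine
  set Φ : MvPolynomial σ k →ₐ[k] Polynomial (MvPolynomial σ k) :=
    aeval (fun i => Polynomial.C (X i) + Polynomial.X * Polynomial.C (X i ^ q)) with hΦ
  rw [← mem_homogeneousSubmodule, ← homogeneousSubmodule_one_pow] at hF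
  induction hF using Submodule.pow_induction_on_left' generalizing j with
  | algebraMap r =>
    rw [AlgHom.commutes, IsScalarTower.algebraMap_apply k (MvPolynomial σ k) (Polynomial _),
        Polynomial.algebraMap_apply, Polynomial.coeff_C]
    split_ifs with h
    · subst h; exact isHomogeneous_C _ _
    · exact isHomogeneous_zero _ _ _
  | add x y i _ _ hx hy =>
    rw [map_add, Polynomial.coeff_add]
    exact (hx j).add (hy j)
  | mem_mul m hm i x _ hx =>
    rw [homogeneousSubmodule_one_eq_span_X] at hm
    induction hm using Submodule.span_induction with
    | mem l hl =>
      obtain ⟨t, rfl⟩ := hl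
      rw [map_mul, hΦ, aeval_X, add_mul, Polynomial.coeff_add, Polynomial.coeff_C_mul, mul_assoc]
      refine IsHomogeneous.add ?_ ?_
      · convert (isHomogeneous_X k t).mul (hx j) using 1; omega
      · cases j with
        | zero => rw [Polynomial.coeff_X_mul_zero]; exact isHomogeneous_zero _ _ _
        | succ j =>
          rw [Polynomial.coeff_X_mul, Polynomial.coeff_C_mul]
          convert (isHomogeneous_X_pow (R := k) t q).mul (hx j) using 1
          obtain ⟨q, rfl⟩ : ∃ q', q = q' + 1 := ⟨q - 1, by omega⟩
          simp only [Nat.add_sub_cancel, Nat.succ_eq_add_one]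
          ring
    | zero => simpa using isHomogeneous_zero _ _ _
    | add a b _ _ ha hb =>
      rw [add_mul, map_add, Polynomial.coeff_add]
      exact ha.add hb
    | smul c a _ ha =>
      rw [smul_mul_assoc, map_smul, Polynomial.coeff_smul]
      exact (homogeneousSubmodule σ k _).smul_mem c ha

/-! ### Linear forms, frames and lines contained in a curve -/

/-- No linear form with coefficients in `K` divides `F`. -/
def HasNoLinearFactor {K : Type*} [Field K] (F : MvPolynomial (Fin 3) K) : Prop :=
  ∀ L : MvPolynomial (Fin 3) K, L ≠ 0 → L.IsHomogeneous 1 → ¬ L ∣ F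

/-- The linear form with given coefficients. -/
noncomputable def linForm {K : Type*} [Field K] (a : Fin 3 → K) : MvPolynomial (Fin 3) K :=
  ∑ i, C (a i) * X i

section Frames

variable {K : Type*} [Field K]

theorem linForm_isHomogeneous (a : Fin 3 → K) : (linForm a).IsHomogeneous 1 :=
  IsHomogeneous.sum _ _ _ fun _ _ => isHomogeneous_C_mul_X _ _

theorem aeval_linForm {A : Type*} [CommRing A] [Algebra K A] (a : Fin 3 → K) (v : Fin 3 → A) :
    aeval v (linForm a) = ∑ i, algebraMap K A (a i) * v i := by
  simp [linForm]

/-- Two independent vectors are part of a basis; the second half of the data is the dual basis. -/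
theorem exists_frame {v₁ v₂ : Fin 3 → K} (h : LinearIndependent K ![v₁, v₂]) :
    ∃ (v₃ : Fin 3 → K) (l : Fin 3 → Fin 3 → K),
      (∀ i, (X i : MvPolynomial (Fin 3) K) = C (v₁ i) * linForm (l 0) + C (v₂ i) * linForm (l 1)
        + C (v₃ i) * linForm (l 2)) ∧
      ∀ j, l j ⬝ᵥ v₁ = (if j = 0 then 1 else 0) ∧ l j ⬝ᵥ v₂ = (if j = 1 then 1 else 0) ∧
        l j ⬝ᵥ v₃ = (if j = 2 then 1 else 0) := by
  classical
  rw [← crossProduct_ne_zero_iff_linearIndependent] at h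
  obtain ⟨t, ht⟩ := Function.ne_iff.1 h
  -- A unit vector at a coordinate where the cross product of `v₁` and `v₂` is nonzero: that
  -- coordinate is the determinant.
  let v₃ : Fin 3 → K := Pi.single t 1
  let M : Matrix (Fin 3) (Fin 3) K := (Matrix.of ![v₁, v₂, v₃]).transpose
  have hdet : M.det ≠ 0 := by
    have h1 : M.det = v₃ ⬝ᵥ (crossProduct v₁ v₂) := by
      rw [Matrix.det_transpose, ← triple_product_permutation, ← triple_product_permutation,
        triple_product_eq_det]
      rfl
    rw [h1]
    simpa [v₃] using ht
  have hu : IsUnit M.det := hdet.isUnit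
  have hM1 : M * M⁻¹ = 1 := Matrix.mul_nonsing_inv _ hu
  have hM2 : M⁻¹ * M = 1 := Matrix.nonsing_inv_mul _ hu
  refine ⟨v₃, fun j => M⁻¹ j, fun i => ?_, fun j => ?_⟩
  · have h1 : ∀ k, (∑ j, M i j * M⁻¹ j k) = if i = k then 1 else 0 := by
      intro k
      rw [← Matrix.mul_apply, hM1, Matrix.one_apply]
    have h2 : ∑ j, C (M i j) * linForm (M⁻¹ j) = (X i : MvPolynomial (Fin 3) K) := by
      simp only [linForm, Finset.mul_sum]
      rw [Finset.sum_comm]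
      have : ∀ k, ∑ j, C (M i j) * (C (M⁻¹ j k) * X k)
          = C (if i = k then 1 else 0) * (X k : MvPolynomial (Fin 3) K) := by
        intro k
        rw [← h1 k, map_sum, Finset.sum_mul]
        refine Finset.sum_congr rfl fun j _ => ?_
        rw [C_mul, mul_assoc]
      rw [Finset.sum_congr rfl fun k _ => this k]
      simp
    rw [← h2, Fin.sum_univ_three]
    rfl
  · have h1 : ∀ k, M⁻¹ j ⬝ᵥ (fun i => M i k) = if j = k then 1 else 0 := by
      intro k
      have := congrFun (congrFun hM2 j) k
      rwa [Matrix.mul_apply', Matrix.one_apply] at this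
    exact ⟨h1 0, h1 1, h1 2⟩

theorem linForm_ne_zero {a v : Fin 3 → K} (h : a ⬝ᵥ v ≠ 0) : linForm a ≠ 0 := by
  intro h0
  apply h
  have := aeval_linForm a v
  rw [h0, map_zero] at this
  rw [dotProduct]
  exact this.symm

/-- A form vanishing identically on a line has a linear factor. -/
theorem alongLine_ne_zero {F : MvPolynomial (Fin 3) K} {e : ℕ} (hF : F.IsHomogeneous e)
    (hlin : HasNoLinearFactor F) {v₁ v₂ : Fin 3 → K} (h : LinearIndependent K ![v₁, v₂]) :
    alongLine F v₂ v₁ ≠ 0 := by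
  intro h0
  obtain ⟨v₃, l, hX, hl⟩ := exists_frame h
  -- The dual coordinate `l 2` cuts out the span of `v₁` and `v₂`. Modulo it the generic point is a
  -- combination of these two vectors, so `F` becomes a sum of coefficients of `alongLine F v₂ v₁`.
  refine hlin (linForm (l 2)) (linForm_ne_zero (v := v₃) (by simp [(hl 2).2.2]))
    (linForm_isHomogeneous _) ?_
  set I : Ideal (MvPolynomial (Fin 3) K) := Ideal.span {linForm (l 2)} with hI
  rw [← Ideal.mem_span_singleton, ← Ideal.Quotient.eq_zero_iff_mem]
  let π := Ideal.Quotient.mkₐ K I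
  have h1 : π F = aeval (fun i => π (X i)) F := by
    rw [← MvPolynomial.aeval_X_left_apply (p := F), ← AlgHom.comp_apply, MvPolynomial.comp_aeval]
    simp
  have h2 : ∀ i, π (X i) = π (linForm (l 1)) * algebraMap K _ (v₂ i)
      + π (linForm (l 0)) * algebraMap K _ (v₁ i) := by
    intro i
    have h3 : π (linForm (l 2)) = 0 :=
      Ideal.Quotient.eq_zero_iff_mem.2 (Ideal.mem_span_singleton_self _)
    rw [hX i]
    simp only [map_add, map_mul, h3, mul_zero, add_zero]
    have : ∀ c : K, π (C c) = algebraMap K _ c := fun c => π.commutes c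
    rw [this, this]
    ring
  change π F = 0
  rw [h1]
  simp only [h2]
  rw [aeval_add_eq_sum_of_isHomogeneous hF]
  have h4 := alongLine_map (Algebra.ofId K (MvPolynomial (Fin 3) K ⧸ I)) F v₂ v₁
  rw [h0, Polynomial.map_zero] at h4
  refine Finset.sum_eq_zero fun j _ => ?_
  have h5 : (alongLine F (fun i => algebraMap K (MvPolynomial (Fin 3) K ⧸ I) (v₂ i))
    (fun i => algebraMap K (MvPolynomial (Fin 3) K ⧸ I) (v₁ i))) = 0 := h4
  rw [h5]
  simp

/-- Three vectors orthogonal to a common nonzero `l` are linearly dependent. The two independence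
hypotheses make the coefficients of `r` and of `u` in the relation nonzero. -/
theorem exists_eq_smul_add_of_dotProduct {p u r l : Fin 3 → K}
    (hpu : LinearIndependent K ![p, u]) (hrp : LinearIndependent K ![r, p]) (hl : l ≠ 0)
    (hp : p ⬝ᵥ l = 0) (hu : u ⬝ᵥ l = 0) (hr : r ⬝ᵥ l = 0) :
    ∃ b c : K, b ≠ 0 ∧ r = b • (u + c • p) := by
  have hdet : (Matrix.of ![p, u, r]).det = 0 := by
    refine Matrix.exists_mulVec_eq_zero_iff.1 ⟨l, hl, ?_⟩
    ext i
    fin_cases i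
    · exact hp
    · exact hu
    · exact hr
  obtain ⟨w, hw0, hw⟩ := Matrix.exists_vecMul_eq_zero_iff.2 hdet
  have hw' : w 0 • p + w 1 • u + w 2 • r = 0 := by
    ext i
    have := congrFun hw i
    simpa [Matrix.vecMul, dotProduct, Fin.sum_univ_three] using this
  rw [LinearIndependent.pair_iff] at hpu hrp
  have h2 : w 2 ≠ 0 := by
    intro h2
    rw [h2, zero_smul, add_zero] at hw'
    obtain ⟨h0, h1⟩ := hpu _ _ hw'
    apply hw0
    ext i
    fin_cases i <;> assumption
  have h1 : w 1 ≠ 0 := by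
    intro h1
    rw [h1, zero_smul, add_zero, add_comm] at hw'
    exact h2 (hrp _ _ hw').1
  refine ⟨- (w 1 / w 2), w 0 / w 1, by simp [h1, h2], ?_⟩
  ext i
  have h3 : w 0 * p i + w 1 * u i + w 2 * r i = 0 := by simpa using congrFun hw' i
  simp only [Pi.smul_apply, Pi.add_apply, smul_eq_mul]
  field_simp
  linear_combination h3

end Frames

/-! ### Rational zeros on lines and in pencils -/

section Counting

variable (K : Type*) [Field K] {E : Type*} [Field E] [Algebra K E]

/-- The `K`-rational zeros in the plane of a form over an extension field. -/
def ratZeros (G : MvPolynomial (Fin 3) E) : Set (ℙ K (Fin 3 → K)) :=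
  {P | aeval (fun i => algebraMap K E (P.rep i)) G = 0}

variable {K}

open Configuration.ofField

theorem linearIndependent_rep {P Q : ℙ K (Fin 3 → K)} (h : P ≠ Q) :
    LinearIndependent K ![P.rep, Q.rep] := by
  rw [LinearIndependent.pair_iff' P.rep_nonzero]
  intro a ha
  apply h
  have ha0 : a ≠ 0 := by
    rintro rfl
    exact Q.rep_nonzero (by simpa using ha.symm)
  rw [← P.mk_rep, ← Q.mk_rep, Projectivization.mk_eq_mk_iff']
  exact ⟨a⁻¹, by rw [← ha, smul_smul, inv_mul_cancel₀ ha0, one_smul]⟩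

theorem dotProduct_rep_eq_zero {P l : ℙ K (Fin 3 → K)} (h : P ∈ l) : P.rep ⬝ᵥ l.rep = 0 := by
  rw [mem_iff, ← P.mk_rep, ← l.mk_rep, Projectivization.orthogonal_mk] at h
  exact h

/-- A point of the line through `P` and `Q`, other than `P`, is `[Q + c P]` for some `c`. -/
theorem exists_rep_eq {P Q R l : ℙ K (Fin 3 → K)} (hPQ : P ≠ Q) (hP : P ∈ l) (hQ : Q ∈ l)
    (hR : R ∈ l) (hRP : R ≠ P) :
    ∃ b c : K, b ≠ 0 ∧ R.rep = b • (Q.rep + c • P.rep) := by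
  exact exists_eq_smul_add_of_dotProduct (linearIndependent_rep hPQ) (linearIndependent_rep hRP)
    l.rep_nonzero (dotProduct_rep_eq_zero hP) (dotProduct_rep_eq_zero hQ)
    (dotProduct_rep_eq_zero hR)

/-- The zeros of a form on a line through `P`, other than `P`, are bounded by the degree of the
form along that line. -/
theorem ncard_ratZeros_line_le [Finite K] {G : MvPolynomial (Fin 3) E} {e r : ℕ}
    (hG : G.IsHomogeneous e) {P l : ℙ K (Fin 3 → K)} (hP : P ∈ l)
    (h : ∀ Q : ℙ K (Fin 3 → K), P ≠ Q →
      let p := alongLine G (fun i => algebraMap K E (Q.rep i)) (fun i => algebraMap K E (P.rep i))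
      p ≠ 0 ∧ p.natDegree ≤ r) :
    {Q | Q ∈ ratZeros K G ∧ Q ∈ l ∧ Q ≠ P}.ncard ≤ r := by
  classical
  rcases Set.eq_empty_or_nonempty {Q | Q ∈ ratZeros K G ∧ Q ∈ l ∧ Q ≠ P} with h0 | ⟨Q, hQ⟩
  · rw [h0]; simp
  obtain ⟨-, hQl, hQP⟩ := hQ
  obtain ⟨hp0, hpr⟩ := h Q hQP.symm
  set p := alongLine G (fun i => algebraMap K E (Q.rep i)) (fun i => algebraMap K E (P.rep i))
  -- The affine coordinate `c R` with respect to `Q` and `P` determines `R`, and it is a root of `p`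
  -- when `R` is a zero of `G`.
  choose! b c hb hc using fun R (hR : R ∈ l ∧ R ≠ P) =>
    exists_rep_eq hQP.symm hP hQl hR.1 hR.2
  calc _ ≤ (p.roots.toFinset : Set E).ncard := by
        refine Set.ncard_le_ncard_of_injOn (fun R => algebraMap K E (c R)) ?_ ?_
          (Finset.finite_toSet _)
        · rintro R ⟨hRG, hR⟩
          simp only [Finset.mem_coe, Multiset.mem_toFinset]
          rw [Polynomial.mem_roots hp0, Polynomial.IsRoot, eval_alongLine]
          have h1 : aeval (fun i => algebraMap K E (R.rep i)) G = 0 := hRG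
          have h2 : (fun i => algebraMap K E (R.rep i)) = fun i => algebraMap K E (b R) *
              (algebraMap K E (Q.rep i) + algebraMap K E (c R) * algebraMap K E (P.rep i)) := by
            ext i
            rw [hc R hR]
            simp
          rw [h2, aeval_mul_of_isHomogeneous hG] at h1
          refine (mul_eq_zero.1 h1).resolve_left (pow_ne_zero _ ?_)
          simpa using hb R hR
        · rintro R ⟨-, hR⟩ R' ⟨-, hR'⟩ hcc
          have hcc' : c R = c R' := (algebraMap K E).injective hcc
          rw [← R.mk_rep, ← R'.mk_rep, Projectivization.mk_eq_mk_iff']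
          refine ⟨b R / b R', ?_⟩
          rw [hc R hR, hc R' hR', hcc', smul_smul, div_mul_cancel₀ _ (hb R' hR')]
    _ ≤ p.natDegree := by
        rw [Set.ncard_coe_finset]
        exact (Multiset.toFinset_card_le _).trans (Polynomial.card_roots' p)
    _ ≤ r := hpr

theorem natDegree_alongLine_le {σ k A : Type*} [CommRing k] [CommRing A] [Algebra k A]
    {F : MvPolynomial σ k} {e : ℕ} (hF : F.IsHomogeneous e) (w u : σ → A) :
    (alongLine F w u).natDegree ≤ e :=
  Polynomial.natDegree_le_iff_coeff_eq_zero.2 fun _ hj => coeff_alongLine_eq_zero hF w u hj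

/-- A line through a point off the curve meets the curve in at most `e` points. -/
theorem ncard_line_le_of_notMem [Finite K] {G : MvPolynomial (Fin 3) E} {e : ℕ}
    (hG : G.IsHomogeneous e) {P l : ℙ K (Fin 3 → K)} (hP : P ∈ l) (hPG : P ∉ ratZeros K G) :
    {Q | Q ∈ ratZeros K G ∧ Q ∈ l ∧ Q ≠ P}.ncard ≤ e := by
  refine ncard_ratZeros_line_le hG hP fun Q _ => ⟨fun h0 => hPG ?_, natDegree_alongLine_le hG _ _⟩
  have := coeff_alongLine_self hG (fun i => algebraMap K E (Q.rep i))
    (fun i => algebraMap K E (P.rep i))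
  rw [h0, Polynomial.coeff_zero] at this
  exact this.symm

/-- A line through a point of a curve without linear components meets the curve in at most
`e - 1` further points. -/
theorem ncard_line_le_of_mem [Finite K] {F : MvPolynomial (Fin 3) K} {e : ℕ}
    (hF : F.IsHomogeneous e) (hlin : HasNoLinearFactor F) {P l : ℙ K (Fin 3 → K)} (hP : P ∈ l)
    (hPF : P ∈ ratZeros K F) :
    {Q | Q ∈ ratZeros K F ∧ Q ∈ l ∧ Q ≠ P}.ncard ≤ e - 1 := by
  refine ncard_ratZeros_line_le hF hP fun Q hPQ =>
    ⟨alongLine_ne_zero hF hlin (linearIndependent_rep hPQ), ?_⟩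
  rw [Polynomial.natDegree_le_iff_coeff_eq_zero]
  intro j hj
  rcases Nat.lt_or_ge e j with h | h
  · exact coeff_alongLine_eq_zero hF _ _ h
  · obtain rfl : j = e := by omega
    rw [coeff_alongLine_self hF]
    exact hPF

/-- A line meets a curve without linear components in at most `e` points. -/
theorem ncard_line_le [Finite K] {F : MvPolynomial (Fin 3) K} {e : ℕ}
    (hF : F.IsHomogeneous e) (he : 1 ≤ e) (hlin : HasNoLinearFactor F) (l : ℙ K (Fin 3 → K)) :
    {Q | Q ∈ ratZeros K F ∧ Q ∈ l}.ncard ≤ e := by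
  rcases Set.eq_empty_or_nonempty {Q | Q ∈ ratZeros K F ∧ Q ∈ l} with h0 | ⟨P, hPF, hPl⟩
  · rw [h0]; simp
  have h1 := ncard_line_le_of_mem hF hlin hPl hPF
  have h2 : {Q | Q ∈ ratZeros K F ∧ Q ∈ l} ⊆
      insert P {Q | Q ∈ ratZeros K F ∧ Q ∈ l ∧ Q ≠ P} := by
    rintro Q ⟨hQ, hQl⟩
    by_cases h : Q = P
    · exact Or.inl h
    · exact Or.inr ⟨hQ, hQl, h⟩
  have h3 := Set.ncard_le_ncard h2 (Set.toFinite _)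
  have h4 := Set.ncard_insert_le P {Q | Q ∈ ratZeros K F ∧ Q ∈ l ∧ Q ≠ P}
  omega

theorem card_plane [Finite K] :
    Nat.card (ℙ K (Fin 3 → K)) = Nat.card K ^ 2 + Nat.card K + 1 := by
  rw [Projectivization.card_of_finrank K (Fin 3 → K) (n := 3) (by simp)]
  simp [Finset.sum_range_succ]
  ring

open Configuration in
theorem card_lines_through [Finite K] (P : ℙ K (Fin 3 → K)) :
    Nat.card {l : ℙ K (Fin 3 → K) // P ∈ l} = Nat.card K + 1 := by
  classical
  have : Fintype (ℙ K (Fin 3 → K)) := Fintype.ofFinite _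
  have h1 := ProjectivePlane.lineCount_eq (L := ℙ K (Fin 3 → K)) P
  have h2 := ProjectivePlane.card_points (ℙ K (Fin 3 → K)) (ℙ K (Fin 3 → K))
  rw [← Nat.card_eq_fintype_card, card_plane] at h2
  have h3 : ProjectivePlane.order (ℙ K (Fin 3 → K)) (ℙ K (Fin 3 → K)) = Nat.card K := by
    nlinarith
  rw [h3] at h1
  exact h1

open Configuration in
theorem exists_line_through {P Q : ℙ K (Fin 3 → K)} (h : P ≠ Q) :
    ∃ l : ℙ K (Fin 3 → K), P ∈ l ∧ Q ∈ l := by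
  classical
  exact ⟨HasLines.mkLine h, HasLines.mkLine_ax h⟩

/-- Counting a set of points along the pencil of lines through a point. -/
theorem ncard_diff_singleton_le [Finite K] {Z : Set (ℙ K (Fin 3 → K))} {P : ℙ K (Fin 3 → K)}
    {r : ℕ} (h : ∀ l : ℙ K (Fin 3 → K), P ∈ l → {Q | Q ∈ Z ∧ Q ∈ l ∧ Q ≠ P}.ncard ≤ r) :
    (Z \ {P}).ncard ≤ (Nat.card K + 1) * r := by
  classical
  have : Fintype {l : ℙ K (Fin 3 → K) // P ∈ l} := Fintype.ofFinite _
  have hsub : Z \ {P} ⊆ ⋃ l : {l : ℙ K (Fin 3 → K) // P ∈ l}, {Q | Q ∈ Z ∧ Q ∈ l.1 ∧ Q ≠ P} := by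
    rintro Q ⟨hQ, hQP⟩
    obtain ⟨l, hl1, hl2⟩ := exists_line_through (Ne.symm hQP)
    exact Set.mem_iUnion.2 ⟨⟨l, hl1⟩, hQ, hl2, hQP⟩
  calc _ ≤ _ := Set.ncard_le_ncard hsub (Set.toFinite _)
    _ ≤ ∑ l : {l : ℙ K (Fin 3 → K) // P ∈ l}, {Q | Q ∈ Z ∧ Q ∈ l.1 ∧ Q ≠ P}.ncard :=
        Set.ncard_iUnion_le_of_fintype _
    _ ≤ ∑ l : {l : ℙ K (Fin 3 → K) // P ∈ l}, r := Finset.sum_le_sum fun l _ => h l.1 l.2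
    _ = _ := by
      rw [Finset.sum_const, smul_eq_mul, Finset.card_univ, ← Nat.card_eq_fintype_card,
        card_lines_through]

end Counting

/-! ### Conics and sets blocking their external lines -/

section Ovals

open Configuration.ofField

variable {K : Type*} [Field K]

theorem mk_mem_ratZeros {E : Type*} [Field E] [Algebra K E] {G : MvPolynomial (Fin 3) E} {e : ℕ}
    (hG : G.IsHomogeneous e) {v : Fin 3 → K} (hv : v ≠ 0) :
    Projectivization.mk K v hv ∈ ratZeros K G ↔ aeval (fun i => algebraMap K E (v i)) G = 0 := by
  obtain ⟨a, ha⟩ := Projectivization.exists_smul_eq_mk_rep K v hv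
  have h : (fun i => algebraMap K E ((Projectivization.mk K v hv).rep i)) =
      fun i => algebraMap K E a * algebraMap K E (v i) := by
    ext i
    rw [← ha, ← map_mul]
    rfl
  rw [ratZeros, Set.mem_ofPred_eq, h, aeval_mul_of_isHomogeneous hG, mul_eq_zero]
  simp

theorem mem_comm_plane {P l : ℙ K (Fin 3 → K)} : P ∈ l ↔ l ∈ P :=
  Projectivization.orthogonal_comm

/-- The polar form of a ternary quadratic form. -/
theorem exists_polar {F : MvPolynomial (Fin 3) K} (hF : F.IsHomogeneous 2) :
    ∃ B : (Fin 3 → K) →ₗ[K] (Fin 3 → K) →ₗ[K] K,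
      ∀ x y, eval (x + y) F = eval x F + eval y F + B x y := by
  rw [← mem_homogeneousSubmodule, ← homogeneousSubmodule_one_pow, pow_two,
    homogeneousSubmodule_one_eq_span_X, Submodule.span_mul_span] at hF
  induction hF using Submodule.span_induction with
  | mem p hp =>
    obtain ⟨_, ⟨i, rfl⟩, _, ⟨j, rfl⟩, rfl⟩ := Set.mem_mul.1 hp
    refine ⟨LinearMap.mk₂ K (fun x y => x i * y j + y i * x j) ?_ ?_ ?_ ?_, ?_⟩
    · intros; simp; ring
    · intros; simp; ring
    · intros; simp; ring
    · intros; simp; ring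
    · intros; simp; ring
  | zero => exact ⟨0, by simp⟩
  | add a b _ _ ha hb =>
    obtain ⟨A, hA⟩ := ha
    obtain ⟨B, hB⟩ := hb
    refine ⟨A + B, fun x y => ?_⟩
    simp only [map_add, hA, hB, LinearMap.add_apply]
    ring
  | smul c a _ ha =>
    obtain ⟨A, hA⟩ := ha
    refine ⟨c • A, fun x y => ?_⟩
    simp only [smul_eval, hA, LinearMap.smul_apply, smul_eq_mul]
    ring

variable [Finite K]

/-- A conic without linear components and with at least two rational points has at least
`q + 1` of them. -/
theorem card_add_one_le_ncard_conic {F : MvPolynomial (Fin 3) K} (hF : F.IsHomogeneous 2)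
    (hlin : HasNoLinearFactor F) (h1 : 1 < (ratZeros K F).ncard) :
    Nat.card K + 1 ≤ (ratZeros K F).ncard := by
  classical
  obtain ⟨P, Q, hP, hQ, hPQ⟩ := (Set.one_lt_ncard_iff (Set.toFinite _)).1 h1
  obtain ⟨B, hB⟩ := exists_polar hF
  set v := P.rep
  set w := Q.rep
  have hv : eval v F = 0 := hP
  have hw : eval w F = 0 := hQ
  have hsc : ∀ (c : K) (x : Fin 3 → K), eval (c • x) F = c ^ 2 * eval x F := fun c x =>
    aeval_mul_of_isHomogeneous hF x c
  have hli : LinearIndependent K ![v, w] := linearIndependent_rep hPQ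
  -- Otherwise all three coefficients of `F` on the line through `P` and `Q` vanish.
  have hBvw : B v w ≠ 0 := by
    intro h0
    refine alongLine_ne_zero hF hlin hli ?_
    have c0 : (alongLine F w v).coeff 0 = 0 := by rw [coeff_alongLine_zero]; exact hw
    have c2 : (alongLine F w v).coeff 2 = 0 := by rw [coeff_alongLine_self hF]; exact hv
    have hs := aeval_add_eq_sum_of_isHomogeneous hF w v 1 1
    have h3 : aeval (fun i => 1 * w i + 1 * v i) F = 0 := by
      have : (fun i => 1 * w i + 1 * v i) = v + w := by ext i; simp [add_comm]
      rw [this]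
      exact (hB v w).trans (by rw [hv, hw, h0]; simp)
    rw [h3] at hs
    simp [Finset.sum_range_succ, c0, c2] at hs
    ext j
    rcases j with _ | _ | _ | j
    · exact c0
    · exact hs.symm
    · exact c2
    · exact coeff_alongLine_eq_zero hF _ _ (by omega)
  obtain ⟨b, l, -, hl⟩ := exists_frame hli
  let u : K → Fin 3 → K := fun t => b + t • w
  -- The second intersection of the conic with the line through `P` and `u t`: since `F(v) = 0`, the
  -- value at `u t + a • v` is `F(u t) + a * B v (u t)`.
  let x : K → Fin 3 → K := fun t => u t + (-(eval (u t) F) / B v (u t)) • v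
  have hl2 : ∀ t, l 2 ⬝ᵥ x t = 1 := by
    intro t
    simp [x, u, dotProduct_add, dotProduct_smul, (hl 2).1, (hl 2).2.1, (hl 2).2.2]
  have hl1 : ∀ t, l 1 ⬝ᵥ x t = t := by
    intro t
    simp [x, u, dotProduct_add, dotProduct_smul, (hl 1).1, (hl 1).2.1, (hl 1).2.2]
  have hx0 : ∀ t, x t ≠ 0 := by
    intro t h0
    have := hl2 t
    rw [h0] at this
    simp at this
  have hxF : ∀ t, B v (u t) ≠ 0 → eval (x t) F = 0 := by
    intro t ht
    have : x t = (-(eval (u t) F) / B v (u t)) • v + u t := add_comm _ _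
    rw [this, hB, hsc, hv, map_smul, LinearMap.smul_apply, smul_eq_mul, div_mul_cancel₀ _ ht]
    ring
  -- `B v (u t)` is affine in `t` with slope `B v w ≠ 0`, so at most one line is tangent at `P`. Its
  -- value is replaced by `Q`, which lies on none of these lines, so injectivity survives.
  let f : K → ℙ K (Fin 3 → K) := fun t => if B v (u t) = 0 then Q else .mk K (x t) (hx0 t)
  have hQ2 : ∀ t, Q ≠ .mk K (x t) (hx0 t) := by
    intro t h
    rw [← Q.mk_rep, Projectivization.mk_eq_mk_iff'] at h
    obtain ⟨a, ha⟩ := h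
    have h1 := hl2 t
    have h2 : l 2 ⬝ᵥ w = 0 := by simpa using (hl 2).2.1
    rw [show w = a • x t from ha.symm, dotProduct_smul, h1] at h2
    apply Q.rep_nonzero
    rw [← ha, show a = 0 by simpa using h2, zero_smul]
  have hP2 : ∀ t, P ≠ .mk K (x t) (hx0 t) := by
    intro t h
    rw [← P.mk_rep, Projectivization.mk_eq_mk_iff'] at h
    obtain ⟨a, ha⟩ := h
    have h1 := hl2 t
    have h2 : l 2 ⬝ᵥ v = 0 := by simpa using (hl 2).1
    rw [show v = a • x t from ha.symm, dotProduct_smul, h1] at h2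
    apply P.rep_nonzero
    rw [← ha, show a = 0 by simpa using h2, zero_smul]
  have hf : Function.Injective f := by
    intro s t hst
    simp only [f] at hst
    split_ifs at hst with hs ht ht
    · have hBs : B v b + s * B v w = 0 := by simpa [u] using hs
      have hBt : B v b + t * B v w = 0 := by simpa [u] using ht
      exact mul_right_cancel₀ hBvw (by linear_combination hBs - hBt)
    · exact absurd hst (hQ2 t)
    · exact absurd hst.symm (hQ2 s)
    · rw [Projectivization.mk_eq_mk_iff'] at hst
      obtain ⟨a, ha⟩ := hst
      have h1 := hl2 s
      rw [← ha, dotProduct_smul, hl2, smul_eq_mul, mul_one] at h1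
      rw [← hl1 s, ← hl1 t, ← ha, h1, one_smul]
  have hfP : ∀ t, f t ≠ P := by
    intro t
    simp only [f]
    split_ifs
    · exact hPQ.symm
    · exact (hP2 t).symm
  have hsub : insert P (Set.range f) ⊆ ratZeros K F := by
    rintro R (rfl | ⟨t, rfl⟩)
    · exact hP
    · simp only [f]
      split_ifs with ht
      · exact hQ
      · exact (mk_mem_ratZeros hF (hx0 t)).2 (hxF t ht)
  calc Nat.card K + 1 = (insert P (Set.range f)).ncard := by
        rw [Set.ncard_insert_of_notMem (by rintro ⟨t, ht⟩; exact hfP t ht) (Set.toFinite _),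
          ← Set.image_univ, Set.ncard_image_of_injective _ hf, Set.ncard_univ]
    _ ≤ _ := Set.ncard_le_ncard hsub (Set.toFinite _)

/-- A set meeting every line external to an oval or hyperoval has at least `q - 1` points. -/
theorem card_le_ncard_add_one_of_blocking {O B : Set (ℙ K (Fin 3 → K))} (hd : Disjoint O B)
    (h2 : ∀ l : ℙ K (Fin 3 → K), {Q | Q ∈ O ∧ Q ∈ l}.ncard ≤ 2)
    (hO : O.ncard = Nat.card K + 1 ∨ O.ncard = Nat.card K + 2)
    (hB : ∀ l : ℙ K (Fin 3 → K), (∀ Q ∈ O, Q ∉ l) → ∃ R ∈ B, R ∈ l) :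
    Nat.card K ≤ B.ncard + 1 := by
  classical
  have : Fintype (ℙ K (Fin 3 → K)) := Fintype.ofFinite _
  let I : ℙ K (Fin 3 → K) → ℙ K (Fin 3 → K) → ℤ := fun R l => if R ∈ l then 1 else 0
  have hI1 : ∀ R, ∑ l, I R l = Nat.card K + 1 := by
    intro R
    simp only [I]
    rw [Finset.sum_boole, ← Fintype.card_subtype, ← Nat.card_eq_fintype_card, card_lines_through]
    rfl
  have hI2 : ∀ R S, R ≠ S → ∑ l, I R l * I S l = 1 := by
    intro R S hRS
    obtain ⟨m, hm1, hm2⟩ := exists_line_through hRS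
    rw [Finset.sum_eq_single_of_mem m (Finset.mem_univ _)]
    · simp [I, hm1, hm2]
    · intro l _ hlm
      simp only [I]
      by_cases h1 : R ∈ l
      · by_cases h2 : S ∈ l
        · exact absurd ((Configuration.Nondegenerate.eq_or_eq h1 h2 hm1 hm2).resolve_left hRS) hlm
        · simp [h2]
      · simp [h1]
  have hsq : ∀ R, ∑ l, I R l * I R l = Nat.card K + 1 := by
    intro R
    rw [← hI1 R]
    exact Finset.sum_congr rfl fun l _ => by simp [I]
  let OF := O.toFinset
  let BF := B.toFinset
  have hOF : (OF.card : ℤ) = O.ncard := by rw [Set.ncard_eq_toFinset_card']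
  have hBF : (BF.card : ℤ) = B.ncard := by rw [Set.ncard_eq_toFinset_card']
  let o : ℙ K (Fin 3 → K) → ℤ := fun l => ∑ R ∈ OF, I R l
  let b : ℙ K (Fin 3 → K) → ℤ := fun l => ∑ R ∈ BF, I R l
  set q : ℤ := (Nat.card K : ℤ) with hq
  have s1 : ∑ l, o l = OF.card * (q + 1) := by
    simp only [o]
    rw [Finset.sum_comm, Finset.sum_congr rfl fun R _ => hI1 R]
    simp
  have s2 : ∑ l, b l = BF.card * (q + 1) := by
    simp only [b]
    rw [Finset.sum_comm, Finset.sum_congr rfl fun R _ => hI1 R]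
    simp
  have s3 : ∑ l, b l * o l = BF.card * OF.card := by
    simp only [b, o, Finset.sum_mul_sum]
    rw [Finset.sum_comm]
    have : ∀ R ∈ BF, ∑ l, ∑ S ∈ OF, I R l * I S l = OF.card := by
      intro R hR
      rw [Finset.sum_comm, Finset.sum_congr rfl fun S hS => hI2 R S ?_]
      · simp
      · rintro rfl
        exact Set.disjoint_left.1 hd (Set.mem_toFinset.1 hS) (Set.mem_toFinset.1 hR)
    rw [Finset.sum_congr rfl this]
    simp
  have s4 : ∑ l, o l * o l = OF.card * (q + OF.card) := by
    simp only [o, Finset.sum_mul_sum]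
    rw [Finset.sum_comm]
    have : ∀ R ∈ OF, ∑ l, ∑ S ∈ OF, I R l * I S l = q + OF.card := by
      intro R hR
      rw [Finset.sum_comm, ← Finset.add_sum_erase _ _ hR, hsq R,
        Finset.sum_congr rfl fun S hS => hI2 R S (Finset.ne_of_mem_erase hS).symm]
      simp only [Finset.sum_const, nsmul_eq_mul, mul_one, Finset.card_erase_of_mem hR]
      have : 1 ≤ OF.card := Finset.card_pos.2 ⟨R, hR⟩
      push_cast [this]
      ring
    rw [Finset.sum_congr rfl this]
    simp
  have s0 : ∑ l : ℙ K (Fin 3 → K), (1 : ℤ) = q ^ 2 + q + 1 := by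
    rw [Finset.sum_const, Finset.card_univ, ← Nat.card_eq_fintype_card, card_plane]
    simp [hq]
  have hb0 : ∀ l, 0 ≤ b l := fun l => Finset.sum_nonneg fun R _ => by simp only [I]; split_ifs <;> simp
  have ho0 : ∀ l, 0 ≤ o l := fun l => Finset.sum_nonneg fun R _ => by simp only [I]; split_ifs <;> simp
  have ho2 : ∀ l, o l ≤ 2 := by
    intro l
    have h := h2 l
    simp only [o, I]
    rw [Finset.sum_boole]
    have h3 : {Q | Q ∈ O ∧ Q ∈ l} = ((OF.filter (· ∈ l) : Finset _) : Set (ℙ K (Fin 3 → K))) := by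
      ext Q; simp [OF]
    rw [h3, Set.ncard_coe_finset] at h
    exact_mod_cast h
  -- The left side vanishes unless the line is external (`o l = 0`), where it is 2 and blocking
  -- supplies `b l ≥ 1`. The factor `2 - o l` makes the sum depend only on first and second moments.
  have key : ∀ l, (1 - o l) * (2 - o l) ≤ b l * (2 - o l) := by
    intro l
    have h1 := hb0 l
    have h2 := ho0 l
    have h3 := ho2 l
    rcases lt_or_ge 0 (o l) with h | h
    · exact mul_le_mul_of_nonneg_right (by omega) (by omega)
    · have h4 : o l = 0 := le_antisymm h h2
      have h5 : ∀ Q ∈ O, Q ∉ l := by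
        intro Q hQ hQl
        have := (Finset.sum_eq_zero_iff_of_nonneg
          (fun R _ => by simp only [I]; split_ifs <;> simp)).1 h4 Q (Set.mem_toFinset.2 hQ)
        simp [I, hQl] at this
      obtain ⟨R, hR, hRl⟩ := hB l h5
      have h6 : 1 ≤ b l := by
        have : I R l ≤ b l := Finset.single_le_sum (f := fun R => I R l)
          (fun R _ => by simp only [I]; split_ifs <;> simp) (Set.mem_toFinset.2 hR)
        simpa [I, hRl] using this
      exact mul_le_mul_of_nonneg_right (by omega) (by omega)
  have hsum := Finset.sum_le_sum fun l (_ : l ∈ Finset.univ) => key l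
  have e1 : ∑ l, (1 - o l) * (2 - o l) =
      2 * (q ^ 2 + q + 1) - 3 * (OF.card * (q + 1)) + OF.card * (q + OF.card) := by
    rw [← s0, ← s1, ← s4, Finset.mul_sum, Finset.mul_sum, ← Finset.sum_sub_distrib,
      ← Finset.sum_add_distrib]
    exact Finset.sum_congr rfl fun l _ => by ring
  have e2 : ∑ l, b l * (2 - o l) = 2 * (BF.card * (q + 1)) - BF.card * OF.card := by
    rw [← s2, ← s3, Finset.mul_sum, ← Finset.sum_sub_distrib]
    exact Finset.sum_congr rfl fun l _ => by ring
  rw [e1, e2, hOF, hBF] at hsum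
  have hq1 : (1 : ℤ) < q := by
    have : 1 < Nat.card K := Finite.one_lt_card
    rw [hq]; exact_mod_cast this
  -- The summed inequality reads `q ^ 2 - q ≤ |B| * (q + 1)` or `q ^ 2 - q ≤ |B| * q`, according to
  -- the size of `O`. Either excludes `|B| ≤ q - 2`.
  have goal : q ≤ B.ncard + 1 := by
    rcases hO with h | h
    · have h' : (O.ncard : ℤ) = q + 1 := by rw [h]; push_cast; rfl
      rw [h'] at hsum
      by_contra hc
      have : (B.ncard : ℤ) ≤ q - 2 := by omega
      nlinarith
    · have h' : (O.ncard : ℤ) = q + 2 := by rw [h]; push_cast; rfl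
      rw [h'] at hsum
      by_contra hc
      have : (B.ncard : ℤ) ≤ q - 2 := by omega
      nlinarith
  rw [hq] at goal
  exact_mod_cast goal

/-- A curve of degree `q` together with a conic misses at least `q - 1` points of the plane. -/
theorem ncard_union_conic_le {F G : MvPolynomial (Fin 3) K} (hF : F.IsHomogeneous (Nat.card K))
    (hG : G.IsHomogeneous 2) (hFl : HasNoLinearFactor F) (hGl : HasNoLinearFactor G) :
    (ratZeros K F ∪ ratZeros K G).ncard ≤ Nat.card K ^ 2 + 2 := by
  have hq1 : 1 < Nat.card K := Finite.one_lt_card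
  rcases Nat.lt_or_ge 1 (ratZeros K G).ncard with hm | hm
  · have hm1 := card_add_one_le_ncard_conic hG hGl hm
    have hm2 : (ratZeros K G).ncard ≤ Nat.card K + 2 := by
      obtain ⟨P, hP⟩ : (ratZeros K G).Nonempty := by
        rw [← Set.ncard_pos]; omega
      have := ncard_diff_singleton_le (Z := ratZeros K G) (P := P) (r := 1)
        fun l hl => ncard_line_le_of_mem hG hGl hl hP
      rw [Set.ncard_sdiff_singleton_of_mem hP] at this
      omega
    have hb := card_le_ncard_add_one_of_blocking (O := ratZeros K G)
      (B := (ratZeros K F ∪ ratZeros K G)ᶜ)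
      (Set.disjoint_left.2 fun Q hQ hQ' => hQ' (Or.inr hQ))
      (fun l => ncard_line_le hG (by norm_num) hGl l) (by omega) ?_
    · rw [Set.ncard_compl, card_plane] at hb
      omega
    -- If an external line missed the complement, all its `q + 1` points would be zeros of `F`,
    -- which has degree `q`.
    · intro l hl
      by_contra! hc
      have h1 : {Q : ℙ K (Fin 3 → K) | Q ∈ l} ⊆ {Q | Q ∈ ratZeros K F ∧ Q ∈ l} := by
        intro Q hQ
        refine ⟨?_, hQ⟩
        by_contra hQF
        exact hc Q (by rintro (h | h); exacts [hQF h, hl Q h hQ]) hQ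
      have h2 := Set.ncard_le_ncard h1 (Set.toFinite _)
      have h3 := ncard_line_le hF (by omega) hFl l
      have h4 : {Q : ℙ K (Fin 3 → K) | Q ∈ l}.ncard = Nat.card K + 1 := by
        rw [← card_lines_through l]
        simp only [mem_comm_plane (P := l)]
        rfl
      omega
  · have h1 : (ratZeros K F).ncard ≤ Nat.card K ^ 2 := by
      rcases (ratZeros K F).eq_empty_or_nonempty with h0 | ⟨P, hP⟩
      · rw [h0]; simp
      · have := ncard_diff_singleton_le (Z := ratZeros K F) (P := P) (r := Nat.card K - 1)
          fun l hl => ncard_line_le_of_mem hF hFl hl hP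
        rw [Set.ncard_sdiff_singleton_of_mem hP] at this
        obtain ⟨n, hn⟩ : ∃ n, Nat.card K = n + 1 := ⟨Nat.card K - 1, by omega⟩
        rw [hn] at this ⊢
        simp only [Nat.add_sub_cancel] at this
        have h5 : (n + 1 + 1) * n + 1 = (n + 1) ^ 2 := by ring
        omega
    have := Set.ncard_union_le (ratZeros K F) (ratZeros K G)
    omega

end Ovals

/-! ### Bezout's inequality with contact multiplicities -/

section Bezout

variable {K : Type*} [Field K]

theorem finrank_homogeneousSubmodule (n : ℕ) :
    Module.finrank K (homogeneousSubmodule (Fin 3) K n) = (n + 2).choose 2 := by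
  classical
  have h1 : homogeneousSubmodule (Fin 3) K n = restrictSupport K {d | d.degree = n} :=
    homogeneousSubmodule_eq_finsupp_supported _ _ _
  rw [h1, Module.finrank_eq_nat_card_basis (basisRestrictSupport K {d : Fin 3 →₀ ℕ | d.degree = n})]
  have h2 : {d : Fin 3 →₀ ℕ | d.degree = n} =
      ((Finset.univ.finsuppAntidiag n : Finset (Fin 3 →₀ ℕ)) : Set (Fin 3 →₀ ℕ)) := by
    ext d
    simp [Finset.mem_finsuppAntidiag, Finsupp.degree_eq_sum]
  rw [h2, Nat.card_coe_set_eq, Set.ncard_coe_finset, Finset.card_finsuppAntidiag_nat_eq_choose]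
  simp only [Finset.card_univ, Fintype.card_fin]
  rw [show 3 + n - 1 = n + 2 by omega, Nat.choose_symm_add]

instance finite_homogeneousSubmodule (n : ℕ) :
    Module.Finite K (homogeneousSubmodule (Fin 3) K n) :=
  Module.Finite.iff_fg.2 (homogeneousSubmodule_fg _ _ _)

theorem two_mul_choose_two (n : ℕ) : 2 * (n + 2).choose 2 = (n + 2) * (n + 1) := by
  rw [Nat.choose_two_right, Nat.mul_div_cancel' (Nat.even_mul_pred_self _).two_dvd]
  rfl

/-- Multiplication by a form of degree `e`, in degree `k`. -/
noncomputable def gradedMul {F : MvPolynomial (Fin 3) K} {e : ℕ} (hF : F.IsHomogeneous e)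
    {k n : ℕ} (h : e + k = n) :
    homogeneousSubmodule (Fin 3) K k →ₗ[K] homogeneousSubmodule (Fin 3) K n :=
  (LinearMap.mulLeft K F).restrict (p := homogeneousSubmodule (Fin 3) K k)
    (q := homogeneousSubmodule (Fin 3) K n) fun _ hx => h ▸ hF.mul hx

/-- In high degree, the forms modulo two coprime forms of degrees `e` and `b` make up a space of
dimension at most `e * b`. -/
theorem finrank_le_mul_of_coprime {F G : MvPolynomial (Fin 3) K} {e b n : ℕ}
    (hF : F.IsHomogeneous e) (hG : G.IsHomogeneous b) (hp : Prime F) (hFG : ¬ F ∣ G)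
    (hn : e + b ≤ n) {M : Type*} [AddCommGroup M] [Module K M]
    (T : homogeneousSubmodule (Fin 3) K n →ₗ[K] M) (hT : Function.Surjective T)
    (hTF : ∀ x : homogeneousSubmodule (Fin 3) K n, F ∣ (x : MvPolynomial (Fin 3) K) → T x = 0)
    (hTG : ∀ x : homogeneousSubmodule (Fin 3) K n, G ∣ (x : MvPolynomial (Fin 3) K) → T x = 0) :
    Module.finrank K M ≤ e * b := by
  obtain ⟨k, rfl⟩ := Nat.exists_eq_add_of_le hn
  -- Degreewise Koszul complex of `F` and `G`: coprimality makes every syzygy a multiple of `(-G,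
  -- F)`, and the dimension of the cokernel is then computed from binomial coefficients.
  let φ : homogeneousSubmodule (Fin 3) K (b + k) × homogeneousSubmodule (Fin 3) K (e + k) →ₗ[K]
      homogeneousSubmodule (Fin 3) K (e + b + k) :=
    (gradedMul hF (by omega)).coprod (gradedMul hG (by omega))
  let ψ : homogeneousSubmodule (Fin 3) K k →ₗ[K]
      homogeneousSubmodule (Fin 3) K (b + k) × homogeneousSubmodule (Fin 3) K (e + k) :=
    (-(gradedMul hG rfl)).prod (gradedMul hF rfl)
  have hker : LinearMap.ker φ ≤ LinearMap.range ψ := by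
    rintro ⟨A, B⟩ hAB
    have h1 : F * (A : MvPolynomial (Fin 3) K) + G * (B : MvPolynomial (Fin 3) K) = 0 :=
      congrArg Subtype.val hAB
    have h2 : F ∣ (B : MvPolynomial (Fin 3) K) := by
      refine (hp.dvd_or_dvd (a := G) ?_).resolve_left hFG
      exact ⟨-A, by linear_combination h1⟩
    obtain ⟨c, hc⟩ := h2
    have hch : c.IsHomogeneous k := by
      by_cases hB : (B : MvPolynomial (Fin 3) K) = 0
      · have : c = 0 := by
          rw [hB] at hc
          exact (mul_eq_zero.1 hc.symm).resolve_left hp.ne_zero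
        rw [this]
        exact isHomogeneous_zero _ _ _
      · have hBh : (F * c).IsHomogeneous (e + k) := hc ▸ B.2
        obtain ⟨i, j, hij, hi, hj⟩ := exists_isHomogeneous_of_mul hBh (hc ▸ hB)
        have : i = e := hi.inj_right hF hp.ne_zero
        obtain rfl : j = k := by omega
        exact hj
    refine ⟨⟨c, hch⟩, ?_⟩
    have hA : (A : MvPolynomial (Fin 3) K) = - (G * c) := by
      apply mul_left_cancel₀ hp.ne_zero
      rw [hc] at h1
      linear_combination h1
    refine Prod.ext (Subtype.ext ?_) (Subtype.ext ?_)
    · exact hA.symm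
    · exact hc.symm
  have hrange : LinearMap.range φ ≤ LinearMap.ker T := by
    rintro _ ⟨⟨A, B⟩, rfl⟩
    have : φ (A, B) = gradedMul hF (by omega) A + gradedMul hG (by omega) B := rfl
    rw [LinearMap.mem_ker, this, map_add, hTF _ (Dvd.intro _ rfl), hTG _ (Dvd.intro _ rfl),
      add_zero]
  have d1 := φ.finrank_range_add_finrank_ker
  have d2 := T.finrank_range_add_finrank_ker
  have d3 := Submodule.finrank_mono hker
  have d4 := Submodule.finrank_mono hrange
  have d5 := LinearMap.finrank_range_le ψ
  rw [LinearMap.range_eq_top.2 hT, finrank_top] at d2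
  rw [Module.finrank_prod] at d1
  simp only [finrank_homogeneousSubmodule] at d1 d2 d5
  have c1 := two_mul_choose_two (b + k)
  have c2 := two_mul_choose_two (e + k)
  have c3 := two_mul_choose_two (e + b + k)
  have c4 := two_mul_choose_two k
  have : (e + b + k + 2) * (e + b + k + 1) + (k + 2) * (k + 1) =
      (b + k + 2) * (b + k + 1) + (e + k + 2) * (e + k + 1) + 2 * (e * b) := by ring
  omega

/-- Parametrization of an affine chart centred at `v`. -/
noncomputable def chart (v a b : Fin 3 → K) : Fin 3 → MvPolynomial (Fin 2) K :=
  fun i => C (v i) + C (a i) * X 0 + C (b i) * X 1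

theorem mem_idealOfVars_iff {σ R : Type*} [CommRing R] (p : MvPolynomial σ R) :
    p ∈ idealOfVars σ R ↔ constantCoeff p = 0 := by
  rw [← pow_one (idealOfVars σ R), mem_pow_idealOfVars_iff']
  constructor
  · intro h
    exact h 0 (by simp)
  · intro h x hx
    have : x = 0 := by
      rw [← Finsupp.degree_eq_zero_iff]
      omega
    rw [this]
    exact h

theorem constantCoeff_aeval_chart (v a b : Fin 3 → K) (F : MvPolynomial (Fin 3) K) :
    constantCoeff (aeval (chart v a b) F) = eval v F := by
  have h : ((constantCoeff : MvPolynomial (Fin 2) K →+* K).comp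
      (aeval (chart v a b) : MvPolynomial (Fin 3) K →ₐ[K] _).toRingHom) = eval v := by
    ext i
    · simp
    · simp [chart]
  exact RingHom.congr_fun h F

/-- Forms of degree at least `k - 1` realize every `(k - 1)`-jet at a point. -/
theorem exists_isHomogeneous_aeval_chart_sub_mem {v a b : Fin 3 → K} {l : Fin 3 → Fin 3 → K}
    (hl : ∀ j, l j ⬝ᵥ v = (if j = 0 then 1 else 0) ∧ l j ⬝ᵥ a = (if j = 1 then 1 else 0) ∧
        l j ⬝ᵥ b = (if j = 2 then 1 else 0)) {k n : ℕ} (hn : k ≤ n + 1)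
    (r : MvPolynomial (Fin 2) K) :
    ∃ g : MvPolynomial (Fin 3) K, g.IsHomogeneous n ∧
      aeval (chart v a b) g - r ∈ idealOfVars (Fin 2) K ^ k := by
  have hL : ∀ j, aeval (chart v a b) (linForm (l j)) =
      (C (l j ⬝ᵥ v) + C (l j ⬝ᵥ a) * X 0 + C (l j ⬝ᵥ b) * X 1 : MvPolynomial (Fin 2) K) := by
    intro j
    rw [aeval_linForm]
    simp only [dotProduct, Fin.sum_univ_three, chart, MvPolynomial.algebraMap_eq, map_add, map_mul]
    ring
  have h0 : aeval (chart v a b) (linForm (l 0)) = 1 := by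
    rw [hL, (hl 0).1, (hl 0).2.1, (hl 0).2.2]; simp
  have h1 : aeval (chart v a b) (linForm (l 1)) = X 0 := by
    rw [hL, (hl 1).1, (hl 1).2.1, (hl 1).2.2]; simp
  have h2 : aeval (chart v a b) (linForm (l 2)) = X 1 := by
    rw [hL, (hl 2).1, (hl 2).2.1, (hl 2).2.2]; simp
  induction r using MvPolynomial.induction_on' with
  | monomial d c =>
    by_cases hd : k ≤ d.degree
    · refine ⟨0, isHomogeneous_zero _ _ _, ?_⟩
      rw [map_zero, zero_sub, neg_mem_iff]
      by_cases hc : c = 0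
      · simp [hc]
      · exact (monomial_mem_pow_idealOfVars_iff k d hc).2 hd
    · have hdd : d.degree = d 0 + d 1 := by
        rw [Finsupp.degree_eq_sum, Fin.sum_univ_two]
      refine ⟨C c * (linForm (l 1) ^ d 0 * linForm (l 2) ^ d 1 *
        linForm (l 0) ^ (n - (d 0 + d 1))), ?_, ?_⟩
      · refine IsHomogeneous.C_mul ?_ c
        have := (((linForm_isHomogeneous (l 1)).pow (d 0)).mul
          ((linForm_isHomogeneous (l 2)).pow (d 1))).mul
          ((linForm_isHomogeneous (l 0)).pow (n - (d 0 + d 1)))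
        convert this using 1
        omega
      · have : aeval (chart v a b) (C c * (linForm (l 1) ^ d 0 * linForm (l 2) ^ d 1 *
          linForm (l 0) ^ (n - (d 0 + d 1)))) = monomial d c := by
          rw [map_mul, map_mul, map_mul, map_pow, map_pow, map_pow, h0, h1, h2, one_pow, mul_one,
            monomial_eq, Finsupp.prod_fintype _ _ (by simp), Fin.prod_univ_two]
          simp
        rw [this, sub_self]
        exact zero_mem _
  | add p q hp hq =>
    obtain ⟨g, hg, hg'⟩ := hp
    obtain ⟨g', hgh, hgh'⟩ := hq
    refine ⟨g + g', hg.add hgh, ?_⟩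
    rw [map_add, add_sub_add_comm]
    exact add_mem hg' hgh'

/-- A plane curve germ meets the `k`-th power of the maximal ideal in colength at least `k`. -/
theorem le_finrank_quotient {f : MvPolynomial (Fin 2) K} (hf : f ∈ idealOfVars (Fin 2) K) (k : ℕ)
    [Module.Finite K (MvPolynomial (Fin 2) K ⧸ idealOfVars (Fin 2) K ^ k)] :
    k ≤ Module.finrank K
      (MvPolynomial (Fin 2) K ⧸ (Ideal.span {f} ⊔ idealOfVars (Fin 2) K ^ k)) := by
  rcases k with _ | k
  · exact Nat.zero_le _
  set m := idealOfVars (Fin 2) K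
  set A := MvPolynomial (Fin 2) K ⧸ m ^ (k + 1)
  let π : MvPolynomial (Fin 2) K →ₐ[K] A := Ideal.Quotient.mkₐ K (m ^ (k + 1))
  have hπ : ∀ x, π x = 0 ↔ x ∈ m ^ (k + 1) := fun x => Ideal.Quotient.eq_zero_iff_mem
  -- Multiplication by `f` on `A` has kernel and cokernel of equal dimension. As `f` has no constant
  -- term, the kernel contains the `k + 1` independent monomials of degree `k`.
  let μ : A →ₗ[K] A := LinearMap.mulLeft K (π f)
  let Q : A →ₗ[K] MvPolynomial (Fin 2) K ⧸ (Ideal.span {f} ⊔ m ^ (k + 1)) :=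
    (Ideal.Quotient.factorₐ K (le_sup_right : m ^ (k + 1) ≤ Ideal.span {f} ⊔ m ^ (k + 1))).toLinearMap
  have hQs : Function.Surjective Q := Ideal.Quotient.factor_surjective
    (le_sup_right : m ^ (k + 1) ≤ Ideal.span {f} ⊔ m ^ (k + 1))
  have hQ : LinearMap.ker Q ≤ LinearMap.range μ := by
    intro x hx
    obtain ⟨r, rfl⟩ := Ideal.Quotient.mk_surjective x
    have h1 : r ∈ Ideal.span {f} ⊔ m ^ (k + 1) := Ideal.Quotient.eq_zero_iff_mem.1 hx
    obtain ⟨y, hy, z, hz, rfl⟩ := Submodule.mem_sup.1 h1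
    obtain ⟨a, rfl⟩ := Ideal.mem_span_singleton'.1 hy
    refine ⟨π a, ?_⟩
    change π f * π a = π (a * f + z)
    rw [map_add, (hπ z).2 hz, map_mul, add_zero, mul_comm]
  let w : Fin (k + 1) → A := fun i => π (X 0 ^ (i : ℕ) * X 1 ^ (k - i))
  let ex : Fin (k + 1) → Fin 2 →₀ ℕ := fun i =>
    Finsupp.single 0 (i : ℕ) + Finsupp.single 1 (k - i)
  have hmon : ∀ i : Fin (k + 1),
      (X 0 ^ (i : ℕ) * X 1 ^ (k - i) : MvPolynomial (Fin 2) K) = monomial (ex i) 1 := by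
    intro i
    rw [X_pow_eq_monomial, X_pow_eq_monomial, monomial_mul, one_mul]
  have hdeg : ∀ i, (ex i).degree = k := by
    intro i
    simp only [ex, map_add, Finsupp.degree_single]
    omega
  have hexinj : Function.Injective ex := by
    intro i j hij
    have := DFunLike.congr_fun hij 0
    simpa [ex, Fin.ext_iff] using this
  have hw : LinearIndependent K w := by
    rw [Fintype.linearIndependent_iff]
    intro c hc i
    have h1 : π (∑ j, c j • monomial (ex j) (1 : K)) = 0 := by
      rw [map_sum, ← hc]
      refine Finset.sum_congr rfl fun j _ => ?_
      rw [map_smul, ← hmon]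
    rw [hπ, mem_pow_idealOfVars_iff'] at h1
    have h2 := h1 (ex i) (by rw [hdeg]; omega)
    rw [coeff_sum] at h2
    simpa [coeff_smul, coeff_monomial, hexinj.eq_iff] using h2
  have hwker : Submodule.span K (Set.range w) ≤ LinearMap.ker μ := by
    rw [Submodule.span_le]
    rintro _ ⟨i, rfl⟩
    change π f * π _ = 0
    rw [← map_mul, hπ, pow_succ', hmon]
    refine Ideal.mul_mem_mul hf ?_
    exact (monomial_mem_pow_idealOfVars_iff k _ one_ne_zero).2 (hdeg i).ge
  have d1 := finrank_span_eq_card hw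
  have d2 := Submodule.finrank_mono hwker
  have d3 := Submodule.finrank_mono hQ
  have d4 := μ.finrank_range_add_finrank_ker
  have d5 := Q.finrank_range_add_finrank_ker
  rw [LinearMap.range_eq_top.2 hQs, finrank_top] at d5
  rw [Fintype.card_fin] at d1
  omega

/-- The forms of degree `k` surject onto the quotient by restriction to a chart. -/
theorem finite_quotient_pow_idealOfVars (k : ℕ) :
    Module.Finite K (MvPolynomial (Fin 2) K ⧸ idealOfVars (Fin 2) K ^ k) := by
  have hli : LinearIndependent K ![(Pi.single 0 1 : Fin 3 → K), Pi.single 1 1] := by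
    rw [LinearIndependent.pair_iff]
    intro s t h
    exact ⟨by simpa using congrFun h 0, by simpa using congrFun h 1⟩
  obtain ⟨b, l, -, hl⟩ := exists_frame hli
  let T : homogeneousSubmodule (Fin 3) K k →ₗ[K]
      MvPolynomial (Fin 2) K ⧸ idealOfVars (Fin 2) K ^ k :=
    ((Ideal.Quotient.mkₐ K (idealOfVars (Fin 2) K ^ k)).toLinearMap ∘ₗ
      (aeval (chart (Pi.single 0 1) (Pi.single 1 1) b)).toLinearMap) ∘ₗ
      (homogeneousSubmodule (Fin 3) K k).subtype
  refine Module.Finite.of_surjective T fun x => ?_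
  obtain ⟨r, rfl⟩ := Ideal.Quotient.mk_surjective x
  obtain ⟨g, hg, hgr⟩ := exists_isHomogeneous_aeval_chart_sub_mem hl (Nat.le_succ k) r
  exact ⟨⟨g, hg⟩, Ideal.Quotient.eq.2 hgr⟩

/-- A polynomial with nonzero constant term is inverted modulo a power of the maximal ideal by a
truncated geometric series. -/
theorem exists_mul_sub_one_mem_pow {p : MvPolynomial (Fin 2) K} (hp : constantCoeff p ≠ 0)
    (k : ℕ) : ∃ u, u * p - 1 ∈ idealOfVars (Fin 2) K ^ k := by
  set c := constantCoeff p
  refine ⟨C c⁻¹ * ∑ i ∈ Finset.range k, (1 - C c⁻¹ * p) ^ i, ?_⟩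
  have h1 : C c⁻¹ * (∑ i ∈ Finset.range k, (1 - C c⁻¹ * p) ^ i) * p - 1 =
      - (1 - C c⁻¹ * p) ^ k := by
    have := geom_sum_mul (1 - C c⁻¹ * p) k
    linear_combination -this
  rw [h1, neg_mem_iff]
  refine Ideal.pow_mem_pow ?_ k
  rw [mem_idealOfVars_iff]
  simp [c, inv_mul_cancel₀ hp]

/-- If two coprime forms of degrees `e` and `b` meet with multiplicity at least `k` at each point
of a finite set of rational points, then `k` times the number of these points is at most
`e * b`. -/
theorem mul_ncard_le_mul_of_coprime [Finite K] {F G : MvPolynomial (Fin 3) K} {e b : ℕ}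
    (hF : F.IsHomogeneous e) (hG : G.IsHomogeneous b) (hp : Prime F) (hFG : ¬ F ∣ G)
    {Z : Set (ℙ K (Fin 3 → K))} (hZ : Z ⊆ ratZeros K F) {k : ℕ}
    (h : ∀ P ∈ Z, ∀ x y : Fin 3 → K, aeval (chart P.rep x y) G ∈
      Ideal.span {aeval (chart P.rep x y) F} ⊔ idealOfVars (Fin 2) K ^ k) :
    k * Z.ncard ≤ e * b := by
  classical
  have : Fintype Z := Fintype.ofFinite _
  have hframe : ∀ P : Z, ∃ (x y : Fin 3 → K) (l : Fin 3 → Fin 3 → K), ∀ j,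
      l j ⬝ᵥ P.1.rep = (if j = 0 then 1 else 0) ∧ l j ⬝ᵥ x = (if j = 1 then 1 else 0) ∧
        l j ⬝ᵥ y = (if j = 2 then 1 else 0) := by
    intro P
    obtain ⟨x, hx⟩ := exists_linearIndependent_pair_of_one_lt_finrank
      (R := K) (M := Fin 3 → K) (by simp) P.1.rep_nonzero
    obtain ⟨y, l, -, hl⟩ := exists_frame hx
    exact ⟨x, y, l, hl⟩
  choose x y l hl using hframe
  let ψ : Z → MvPolynomial (Fin 3) K →ₐ[K] MvPolynomial (Fin 2) K :=
    fun P => aeval (chart P.1.rep (x P) (y P))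
  let J : Z → Ideal (MvPolynomial (Fin 2) K) :=
    fun P => Ideal.span {ψ P F} ⊔ idealOfVars (Fin 2) K ^ k
  have hsep : ∀ P Q : Z, ∃ L : MvPolynomial (Fin 3) K, L.IsHomogeneous 1 ∧
      (P ≠ Q → eval P.1.rep L ≠ 0 ∧ eval Q.1.rep L = 0) := by
    intro P Q
    by_cases hPQ : P = Q
    · exact ⟨0, isHomogeneous_zero _ _ _, fun h => absurd hPQ h⟩
    obtain ⟨_, m, -, hm⟩ := exists_frame
      (linearIndependent_rep (P := Q.1) (Q := P.1) fun h => hPQ (Subtype.ext h.symm))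
    have hev : ∀ v : Fin 3 → K, eval v (linForm (m 1)) = m 1 ⬝ᵥ v := fun v => aeval_linForm _ _
    exact ⟨linForm (m 1), linForm_isHomogeneous _, fun _ =>
      ⟨by rw [hev, (hm 1).2.1]; simp, by rw [hev, (hm 1).1]; simp⟩⟩
  choose L hL1 hL using hsep
  -- `D P` is a unit in the local ring at `P` and vanishes to order `k` at the other points of `Z`,
  -- which allows interpolation of independent jets.
  let D : Z → MvPolynomial (Fin 3) K := fun P => ∏ Q ∈ Finset.univ.erase P, L P Q ^ k
  set c := k * (Fintype.card Z - 1)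
  have hD : ∀ P, (D P).IsHomogeneous c := by
    intro P
    have := IsHomogeneous.prod (Finset.univ.erase P) (fun Q => L P Q ^ k) (fun _ => 1 * k)
      fun Q _ => (hL1 P Q).pow k
    convert this using 1
    simp [c, mul_comm]
  have hDP : ∀ P, constantCoeff (ψ P (D P)) ≠ 0 := by
    intro P
    rw [constantCoeff_aeval_chart, map_prod, Finset.prod_ne_zero_iff]
    intro Q hQ
    rw [map_pow]
    exact pow_ne_zero _ (hL P Q (Finset.ne_of_mem_erase hQ).symm).1
  have hDQ : ∀ P Q, P ≠ Q → ψ Q (D P) ∈ idealOfVars (Fin 2) K ^ k := by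
    intro P Q hPQ
    simp only [D]
    rw [map_prod]
    refine Ideal.mem_of_dvd _ (Finset.dvd_prod_of_mem _
      (Finset.mem_erase.2 ⟨hPQ.symm, Finset.mem_univ Q⟩)) ?_
    rw [map_pow]
    refine Ideal.pow_mem_pow ?_ k
    rw [mem_idealOfVars_iff, constantCoeff_aeval_chart]
    exact (hL P Q hPQ).2
  choose u hu using fun P => exists_mul_sub_one_mem_pow (hDP P) k
  -- Degree `c` is used up by `D P`; the remaining `e + b + k` suffices to prescribe jets and to
  -- reach the range of `finrank_le_mul_of_coprime`.
  let T : homogeneousSubmodule (Fin 3) K (c + (e + b + k)) →ₗ[K]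
      ((P : Z) → MvPolynomial (Fin 2) K ⧸ J P) :=
    LinearMap.pi fun P => ((Ideal.Quotient.mkₐ K (J P)).toLinearMap ∘ₗ (ψ P).toLinearMap) ∘ₗ
      (homogeneousSubmodule (Fin 3) K (c + (e + b + k))).subtype
  have hTapp : ∀ g P, T g P = Ideal.Quotient.mk (J P) (ψ P g) := fun _ _ => rfl
  have hTs : Function.Surjective T := by
    intro t
    choose r hr using fun P => Ideal.Quotient.mk_surjective (t P)
    choose g hg hgr using fun P => exists_isHomogeneous_aeval_chart_sub_mem (hl P)
      (show k ≤ e + b + k + 1 by omega) (u P * r P)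
    refine ⟨⟨∑ P, D P * g P, IsHomogeneous.sum _ _ _ fun P _ => (hD P).mul (hg P)⟩, ?_⟩
    funext Q
    rw [hTapp, ← hr Q, Ideal.Quotient.eq]
    refine le_sup_right (a := Ideal.span {ψ Q F}) ?_
    simp only
    rw [map_sum, ← Finset.add_sum_erase _ _ (Finset.mem_univ Q), add_sub_right_comm]
    refine add_mem ?_ (sum_mem fun P hP => ?_)
    · rw [map_mul]
      have e1 : ψ Q (D Q) * ψ Q (g Q) - r Q = ψ Q (D Q) * (ψ Q (g Q) - u Q * r Q)
          + r Q * (u Q * ψ Q (D Q) - 1) := by ring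
      rw [e1]
      exact add_mem (Ideal.mul_mem_left _ _ (hgr Q)) (Ideal.mul_mem_left _ _ (hu Q))
    · rw [map_mul]
      exact Ideal.mul_mem_right _ _ (hDQ P Q (Finset.ne_of_mem_erase hP))
  have hbez := finrank_le_mul_of_coprime hF hG hp hFG (by omega) T hTs
    (by
      rintro ⟨_, _⟩ ⟨a, rfl⟩
      funext P
      rw [hTapp, map_mul]
      refine Ideal.Quotient.eq_zero_iff_mem.2 (Ideal.mul_mem_right _ _ ?_)
      exact le_sup_left (b := idealOfVars (Fin 2) K ^ k) (Ideal.mem_span_singleton_self _))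
    (by
      rintro ⟨_, _⟩ ⟨a, rfl⟩
      funext P
      rw [hTapp, map_mul]
      exact Ideal.Quotient.eq_zero_iff_mem.2 (Ideal.mul_mem_right _ _ (h P.1 P.2 _ _)))
  have := finite_quotient_pow_idealOfVars (K := K) k
  have hfin : ∀ P, Module.Finite K (MvPolynomial (Fin 2) K ⧸ J P) := fun P =>
    Module.Finite.of_surjective (Ideal.Quotient.factorₐ K
      (le_sup_right : idealOfVars (Fin 2) K ^ k ≤ J P)).toLinearMap
      (Ideal.Quotient.factor_surjective le_sup_right)
  rw [Module.finrank_pi_fintype] at hbez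
  refine le_trans ?_ hbez
  have hk : ∀ P, k ≤ Module.finrank K (MvPolynomial (Fin 2) K ⧸ J P) := by
    intro P
    refine le_finrank_quotient ?_ k
    rw [mem_idealOfVars_iff, constantCoeff_aeval_chart]
    exact hZ P.2
  calc k * Z.ncard = ∑ _P : Z, k := by
        rw [Finset.sum_const, smul_eq_mul, Finset.card_univ, ← Nat.card_eq_fintype_card,
          Nat.card_coe_set_eq, mul_comm]
    _ ≤ _ := Finset.sum_le_sum fun P _ => hk P

end Bezout

/-! ### The line joining a point to its Frobenius image, and Sziklai's bound for prime forms -/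

section Frobenius

variable {K : Type*} [Field K]

/-- The coefficients of a form along the line joining the generic point to its Frobenius
image. -/
noncomputable def frobCoeff {σ : Type*} (F : MvPolynomial σ K) (k : ℕ) : MvPolynomial σ K :=
  (alongLine F (fun i => (X i : MvPolynomial σ K)) (fun i => X i ^ Nat.card K)).coeff k

theorem aeval_frobCoeff {σ R : Type*} [CommRing R] [Algebra K R] (F : MvPolynomial σ K) (k : ℕ)
    (w : σ → R) :
    aeval w (frobCoeff F k) = (alongLine F w (fun i => w i ^ Nat.card K)).coeff k := by
  have h := alongLine_map (aeval w) F (fun i => (X i : MvPolynomial σ K))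
    (fun i => X i ^ Nat.card K)
  simp only [aeval_X, map_pow] at h
  rw [h, Polynomial.coeff_map]
  rfl

theorem not_dvd_linForm {F : MvPolynomial (Fin 3) K} {e : ℕ} (hF : F.IsHomogeneous e) (he : 1 ≤ e)
    (hF0 : F ≠ 0) (hlin : HasNoLinearFactor F) {a : Fin 3 → K} (ha : linForm a ≠ 0) :
    ¬ F ∣ linForm a := by
  rintro ⟨c, hc⟩
  have h1 : (F * c).IsHomogeneous 1 := hc ▸ linForm_isHomogeneous a
  obtain ⟨i, j, hij, hi, -⟩ := exists_isHomogeneous_of_mul h1 (hc ▸ ha)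
  have := hi.inj_right hF hF0
  obtain rfl : e = 1 := by omega
  exact hlin F hF0 hF dvd_rfl

theorem frobCoeff_zero {σ : Type*} (F : MvPolynomial σ K) : frobCoeff F 0 = F := by
  rw [frobCoeff, coeff_alongLine_zero]
  exact aeval_X_left_apply F

/-- Each `w i + λ δ i` lies in the Rees algebra of `m`, which is a subalgebra and so contains every
polynomial expression in them. -/
theorem coeff_alongLine_mem_pow {σ R : Type*} [CommRing R] [Algebra K R] (F : MvPolynomial σ K)
    (w δ : σ → R) {m : Ideal R} (hδ : ∀ i, δ i ∈ m) (j : ℕ) :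
    (alongLine F w δ).coeff j ∈ m ^ j := by
  revert j
  rw [← mem_reesAlgebra_iff]
  have hmem : ∀ i, Polynomial.C (w i) + Polynomial.X * Polynomial.C (δ i) ∈ reesAlgebra m := by
    intro i
    refine add_mem ((reesAlgebra m).algebraMap_mem (w i)) ?_
    rw [mul_comm, Polynomial.C_mul_X_eq_monomial]
    exact reesAlgebra.monomial_mem.2 (by rw [pow_one]; exact hδ i)
  rw [alongLine, aeval_def, eval₂_eq]
  refine sum_mem fun d _ => mul_mem ?_ (prod_mem fun i _ => pow_mem (hmem i) _)
  rw [IsScalarTower.algebraMap_apply K R (Polynomial R)]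
  exact (reesAlgebra m).algebraMap_mem _

theorem dvd_aeval_add_pow {σ R : Type*} [CommRing R] [Algebra K R] {F : MvPolynomial σ K} {e : ℕ}
    (hF : F.IsHomogeneous e) (h : ∀ k ≤ e, F ∣ frobCoeff F k) (w : σ → R) (α β : R) :
    aeval w F ∣ aeval (fun i => α * w i + β * w i ^ Nat.card K) F := by
  rw [aeval_add_eq_sum_of_isHomogeneous hF w (fun i => w i ^ Nat.card K)]
  refine Finset.dvd_sum fun j hj => Dvd.dvd.mul_left ?_ _
  rw [← aeval_frobCoeff]
  exact map_dvd _ (h j (Nat.lt_succ_iff.1 (Finset.mem_range.1 hj)))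

/-- Rewrites `w + λ (w ^ q - w)` as `(1 - λ) w + λ w ^ q` and applies the homogeneous expansion. The
displacement `w ^ q - w` is small near rational points. -/
theorem alongLine_sub_pow_card {σ R : Type*} [CommRing R] [Algebra K R] {F : MvPolynomial σ K}
    {e : ℕ} (hF : F.IsHomogeneous e) (w : σ → R) :
    alongLine F w (fun i => w i ^ Nat.card K - w i) = ∑ j ∈ Finset.range (e + 1),
      (1 - Polynomial.X) ^ (e - j) * Polynomial.X ^ j *
        Polynomial.C (aeval w (frobCoeff F j)) := by
  have h1 := aeval_add_eq_sum_of_isHomogeneous hF (fun i => Polynomial.C (w i))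
    (fun i => Polynomial.C (w i ^ Nat.card K)) (1 - Polynomial.X) Polynomial.X
  have h2 : alongLine F (fun i => Polynomial.C (w i)) (fun i => Polynomial.C (w i ^ Nat.card K)) =
      (alongLine F w (fun i => w i ^ Nat.card K)).map Polynomial.C :=
    alongLine_map (Polynomial.CAlgHom (R := K)) F w (fun i => w i ^ Nat.card K)
  have h3 : (fun i => Polynomial.C (w i) + Polynomial.X * Polynomial.C (w i ^ Nat.card K - w i)) =
      fun i => (1 - Polynomial.X) * Polynomial.C (w i) +
        Polynomial.X * Polynomial.C (w i ^ Nat.card K) := by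
    funext i
    rw [Polynomial.C_sub]
    ring
  rw [alongLine, h3, h1, h2]
  refine Finset.sum_congr rfl fun j _ => ?_
  rw [Polynomial.coeff_map, aeval_frobCoeff]

variable [Finite K]

theorem exists_frobenius (R : Type*) [CommRing R] [Algebra K R] :
    ∃ f : R →ₐ[K] R, ∀ x, f x = x ^ Nat.card K := by
  have : Fintype K := Fintype.ofFinite K
  refine ⟨FiniteField.frobeniusAlgHom K R, fun x => ?_⟩
  rw [Nat.card_eq_fintype_card, FiniteField.coe_frobeniusAlgHom]

theorem aeval_pow_card {σ R : Type*} [CommRing R] [Algebra K R] (w : σ → R)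
    (F : MvPolynomial σ K) :
    aeval (fun i => w i ^ Nat.card K) F = (aeval w F) ^ Nat.card K := by
  obtain ⟨f, hf⟩ := exists_frobenius (K := K) R
  rw [← hf, ← AlgHom.comp_apply, comp_aeval]
  simp only [hf]

theorem isHomogeneous_frobCoeff {σ : Type*} {F : MvPolynomial σ K} {e : ℕ}
    (hF : F.IsHomogeneous e) (k : ℕ) :
    (frobCoeff F k).IsHomogeneous (e + (Nat.card K - 1) * k) :=
  isHomogeneous_coeff_alongLine Nat.card_pos hF k

/-- Over `K` the polynomial `X ^ q - X` is already the product of all `X - c`, so it has no further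
roots in `L`. -/
theorem exists_algebraMap_eq_of_pow_card_eq {L : Type*} [Field L] [Algebra K L] {t : L}
    (ht : t ^ Nat.card K = t) : ∃ c : K, t = algebraMap K L c := by
  have : Fintype K := Fintype.ofFinite K
  have h1 : Polynomial.aeval t (Polynomial.X ^ Fintype.card K - Polynomial.X : Polynomial K) = 0 := by
    simp [← Nat.card_eq_fintype_card, ht]
  have hnat := FiniteField.X_pow_card_sub_X_natDegree_eq K (Fintype.one_lt_card (α := K))
  have hroots := FiniteField.roots_X_pow_card_sub_X K
  rw [← Polynomial.prod_multiset_X_sub_C_of_monic_of_roots_card_eq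
    (Polynomial.monic_X_pow_sub (by
      rw [Polynomial.degree_X]; exact_mod_cast Fintype.one_lt_card (α := K)))
    (by rw [hroots, hnat]; rfl), hroots] at h1
  have h2 : ∏ c : K, (t - algebraMap K L c) = 0 := by
    rw [← h1]
    change _ = Polynomial.aeval t (∏ c : K, (Polynomial.X - Polynomial.C c))
    simp [map_prod]
  obtain ⟨c, -, hc⟩ := Finset.prod_eq_zero_iff.1 h2
  exact ⟨c, sub_eq_zero.1 hc⟩

/-- A prime dividing `a ^ q * b - a * b ^ q` divides a `K`-linear combination of `a` and `b`. -/
theorem dvd_or_exists_dvd_sub {R : Type*} [CommRing R] [Algebra K R] {p a b : R} (hp : Prime p)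
    (h : p ∣ a ^ Nat.card K * b - a * b ^ Nat.card K) :
    p ∣ b ∨ ∃ c : K, p ∣ a - algebraMap K R c * b := by
  have hprime : (Ideal.span {p}).IsPrime := (Ideal.span_singleton_prime hp.ne_zero).2 hp
  set D := R ⧸ Ideal.span {p}
  let π : R →ₐ[K] D := Ideal.Quotient.mkₐ K (Ideal.span {p})
  have hπ : ∀ x, π x = 0 ↔ p ∣ x := fun x =>
    Ideal.Quotient.eq_zero_iff_mem.trans Ideal.mem_span_singleton
  let L := FractionRing D
  let ι : D →ₐ[K] L := IsScalarTower.toAlgHom K D L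
  have hι : Function.Injective ι := IsFractionRing.injective D L
  rcases eq_or_ne (π b) 0 with hb | hb
  · exact Or.inl ((hπ b).1 hb)
  right
  have hb' : ι (π b) ≠ 0 := fun h0 => hb (hι (by rw [h0, map_zero]))
  have h1 : ι (π a) ^ Nat.card K * ι (π b) = ι (π a) * ι (π b) ^ Nat.card K := by
    have := (hπ _).2 h
    rw [map_sub, map_mul, map_mul, map_pow, map_pow, sub_eq_zero] at this
    simpa using congrArg ι this
  obtain ⟨c, hc⟩ := exists_algebraMap_eq_of_pow_card_eq (K := K) (t := ι (π a) / ι (π b)) (by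
    have hq : Nat.card K ≠ 0 := Nat.card_pos.ne'
    rw [div_pow, div_eq_div_iff (pow_ne_zero _ hb') hb', h1])
  refine ⟨c, (hπ _).1 (hι ?_)⟩
  rw [div_eq_iff hb'] at hc
  rw [map_sub, map_mul, map_sub, hc, map_mul, map_zero, AlgHom.commutes, AlgHom.commutes, sub_self]

/-- The degree bound is sharp: `x ^ q * y - x * y ^ q` has degree `q + 1` and vanishes at every
rational vector. -/
theorem exists_eval_ne_zero {F : MvPolynomial (Fin 3) K} {e : ℕ} (hF : F.IsHomogeneous e)
    (he : e ≤ Nat.card K) (hF0 : F ≠ 0) : ∃ v : Fin 3 → K, eval v F ≠ 0 := by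
  by_contra! h
  refine hF0 (hF.eq_zero_of_forall_eval_eq_zero_of_le_card h ?_)
  rw [← Nat.cast_card]
  exact_mod_cast he

/-- For an irreducible curve other than a line, the line joining the generic point to its
Frobenius image is not contained in the curve. -/
theorem exists_not_dvd_frobCoeff {F : MvPolynomial (Fin 3) K} {e : ℕ} (hF : F.IsHomogeneous e)
    (he : 1 ≤ e) (heq : e ≤ Nat.card K) (hp : Prime F) (hlin : HasNoLinearFactor F) :
    ∃ k ≤ e, ¬ F ∣ frobCoeff F k := by
  by_contra! h
  obtain ⟨v₁, hv₁⟩ := exists_eval_ne_zero hF heq hp.ne_zero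
  have hv0 : v₁ ≠ 0 := by
    rintro rfl
    apply hv₁
    have := aeval_mul_of_isHomogeneous hF (0 : Fin 3 → K) 0
    rw [zero_pow (by omega), zero_mul] at this
    simpa using this
  obtain ⟨v₂, hli⟩ := exists_linearIndependent_pair_of_one_lt_finrank
      (R := K) (M := Fin 3 → K) (by simp) hv0
  obtain ⟨v₃, l, hX, hl⟩ := exists_frame hli
  set q := Nat.card K with hq
  set x := linForm (l 0)
  set y := linForm (l 1)
  set z := linForm (l 2)
  obtain ⟨φ, hφ⟩ := exists_frobenius (K := K) (MvPolynomial (Fin 3) K)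
  have hφC : ∀ c : K, φ (C c) = C c := fun c => φ.commutes c
  -- Moving along the Frobenius line by `z ^ q` and `-z` eliminates the `v₃` component of the
  -- generic point. Repeating this with `U` eliminates `v₂`, leaving a multiple of `v₁`, where `F`
  -- is nonzero.
  set V := z ^ q * x - z * x ^ q with hV
  set U := z ^ q * y - z * y ^ q with hU
  have hY : ∀ i, z ^ q * X i + (-z) * X i ^ q = C (v₁ i) * V + C (v₂ i) * U := by
    intro i
    rw [← hφ (X i), hX i]
    simp only [map_add, map_mul, hφC]
    rw [hφ, hφ, hφ, hV, hU]
    ring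
  have h1 := dvd_aeval_add_pow hF h (fun i => (X i : MvPolynomial (Fin 3) K)) (z ^ q) (-z)
  have h2 := dvd_aeval_add_pow hF h (fun i => C (v₁ i) * V + C (v₂ i) * U) (U ^ q) (-U)
  simp only [← hq, hY] at h1
  have hid : (aeval fun i => (X i : MvPolynomial (Fin 3) K)) F = F := aeval_X_left_apply F
  rw [hid] at h1
  have hY2 : (fun i => U ^ q * (C (v₁ i) * V + C (v₂ i) * U) +
      -U * (C (v₁ i) * V + C (v₂ i) * U) ^ q) =
      fun i => (U ^ q * V - U * V ^ q) * algebraMap K (MvPolynomial (Fin 3) K) (v₁ i) := by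
    ext1 i
    rw [← hφ (C (v₁ i) * V + C (v₂ i) * U)]
    simp only [map_add, map_mul, hφC]
    rw [hφ, hφ, MvPolynomial.algebraMap_eq]
    ring
  rw [← hq, hY2, aeval_mul_of_isHomogeneous hF] at h2
  have h3 : aeval (fun i => algebraMap K (MvPolynomial (Fin 3) K) (v₁ i)) F
      = C (eval v₁ F) := by
    have := MvPolynomial.aeval_algebraMap_apply (MvPolynomial (Fin 3) K) v₁ F
    rw [← MvPolynomial.algebraMap_eq]
    exact this
  rw [h3] at h2
  have hunit : IsUnit (C (eval v₁ F) : MvPolynomial (Fin 3) K) := hv₁.isUnit.map C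
  have h4 : F ∣ V ^ q * U - V * U ^ q := by
    have h5 := (h1.trans h2)
    rw [hunit.dvd_mul_right] at h5
    have h6 := hp.dvd_of_dvd_pow h5
    rw [← dvd_neg]
    convert h6 using 1
    ring
  have hlinear : ∀ c c' : Fin 3 → K, c ⬝ᵥ c' ≠ 0 → ¬ F ∣ linForm c := fun c c' hc =>
    not_dvd_linForm hF he hp.ne_zero hlin (linForm_ne_zero hc)
  have hz : ¬ F ∣ z := hlinear (l 2) v₃ (by simp [(hl 2).2.2])
  have hadd : ∀ a b : Fin 3 → K, ∀ c : K, linForm a - C c * linForm b = linForm (a - c • b) := by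
    intro a b c
    simp only [linForm, Finset.mul_sum, ← Finset.sum_sub_distrib]
    refine Finset.sum_congr rfl fun i _ => ?_
    simp only [Pi.sub_apply, Pi.smul_apply, smul_eq_mul, C_sub, C_mul]
    ring
  have hstep : ∀ a : Fin 3 → K, F ∣ z ^ q * linForm a - z * linForm a ^ q →
      ∃ c : K, F ∣ linForm (a - c • l 2) := by
    intro a ha
    have ha' : F ∣ linForm a ^ q * z - linForm a * z ^ q := by
      rw [← dvd_neg]
      convert ha using 1
      ring
    rcases dvd_or_exists_dvd_sub hp ha' with h' | ⟨c, hc⟩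
    · exact absurd h' hz
    · exact ⟨c, by rwa [MvPolynomial.algebraMap_eq, hadd] at hc⟩
  -- Modulo `F`, either `U` vanishes or `V / U` is fixed by Frobenius, hence a constant. One more
  -- use of the same principle makes `F` divide a nonzero linear form.
  rcases dvd_or_exists_dvd_sub hp h4 with h5 | ⟨c, hc⟩
  · obtain ⟨c, hc⟩ := hstep (l 1) h5
    refine hlinear _ v₂ ?_ hc
    simp [sub_dotProduct, (hl 1).2.1, (hl 2).2.1]
  · have h6 : V - algebraMap K _ c * U = z ^ q * linForm (l 0 - c • l 1) -
        z * linForm (l 0 - c • l 1) ^ q := by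
      rw [← hadd, ← hφ (linForm (l 0) - C c * linForm (l 1)), map_sub, map_mul, hφC, hφ, hφ,
        MvPolynomial.algebraMap_eq]
      ring
    rw [h6] at hc
    obtain ⟨c', hc'⟩ := hstep _ hc
    refine hlinear _ v₁ ?_ hc'
    simp [sub_dotProduct, (hl 0).1, (hl 1).1, (hl 2).1]

theorem frobCoeff_self {σ : Type*} {F : MvPolynomial σ K} {e : ℕ} (hF : F.IsHomogeneous e) :
    frobCoeff F e = F ^ Nat.card K := by
  rw [frobCoeff, coeff_alongLine_self hF, aeval_pow_card]
  congr 1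
  exact aeval_X_left_apply F

/-- The first coefficient along the Frobenius line which does not vanish on the curve has contact
of order greater than its index at the rational points. -/
theorem aeval_chart_frobCoeff_mem {F : MvPolynomial (Fin 3) K} {e k : ℕ} (hF : F.IsHomogeneous e)
    (hk : k ≤ e) (h : ∀ j < k, F ∣ frobCoeff F j) (v a b : Fin 3 → K) :
    aeval (chart v a b) (frobCoeff F k) ∈
      Ideal.span {aeval (chart v a b) F} ⊔ idealOfVars (Fin 2) K ^ (k + 1) := by
  set w := chart v a b with hw
  set q := Nat.card K with hq
  set J := Ideal.span {aeval w F} with hJ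
  set m := idealOfVars (Fin 2) K with hm
  set c : ℕ → MvPolynomial (Fin 2) K := fun j => aeval w (frobCoeff F j) with hc
  have hcJ : ∀ j < k, c j ∈ J := fun j hj => Ideal.mem_span_singleton.2 (map_dvd _ (h j hj))
  -- The centre `v` is rational, so `δ` has no constant term and the `j`-th coefficient of `H` lies
  -- in `m ^ j`.
  let δ : Fin 3 → MvPolynomial (Fin 2) K := fun i => w i ^ q - w i
  have hδ : ∀ i, δ i ∈ m := by
    intro i
    rw [mem_idealOfVars_iff]
    have : Fintype K := Fintype.ofFinite K
    simp only [δ, w, chart, map_sub, map_pow, map_add, map_mul, constantCoeff_C, constantCoeff_X,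
      mul_zero, add_zero, hq, Nat.card_eq_fintype_card, FiniteField.pow_card, sub_self]
  set H := alongLine F w δ with hH
  have hHm : ∀ j, H.coeff j ∈ m ^ j := fun j => coeff_alongLine_mem_pow F w δ hδ j
  have hHexp : H = ∑ j ∈ Finset.range (e + 1),
      (1 - Polynomial.X) ^ (e - j) * Polynomial.X ^ j * Polynomial.C (c j) :=
    alongLine_sub_pow_card hF w
  have hcoeff : ∀ j, H.coeff j = ∑ i ∈ Finset.range (e + 1),
      if i ≤ j then ((1 - Polynomial.X : Polynomial (MvPolynomial (Fin 2) K)) ^ (e - i)).coeff (j - i)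
        * c i else 0 := by
    intro j
    rw [hHexp, Polynomial.finsetSum_coeff]
    refine Finset.sum_congr rfl fun i _ => ?_
    rw [Polynomial.coeff_mul_C, Polynomial.coeff_mul_X_pow']
    split_ifs <;> simp
  have hlow : ∀ j < k, H.coeff j ∈ J := by
    intro j hj
    rw [hcoeff]
    refine sum_mem fun i _ => ?_
    split_ifs with hij
    · exact Ideal.mul_mem_left _ _ (hcJ i (by omega))
    · exact zero_mem _
  have hmid : H.coeff k - c k ∈ J := by
    rw [hcoeff, ← Finset.add_sum_erase _ _ (Finset.mem_range.2 (Nat.lt_succ_of_le hk)),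
      add_sub_right_comm]
    refine add_mem ?_ (sum_mem fun i hi => ?_)
    · simp [Polynomial.coeff_zero_eq_eval_zero]
    · split_ifs with hik
      · exact Ideal.mul_mem_left _ _ (hcJ i (lt_of_le_of_ne hik (Finset.ne_of_mem_erase hi)))
      · exact zero_mem _
  -- At `λ = 1` the line reaches the Frobenius image, where the value is `F(w) ^ q`. Modulo `J` this
  -- turns the `k`-th coefficient into minus the sum of the later ones, which raises its order from
  -- `k` to `k + 1`.
  have hsum : ∑ j ∈ Finset.range (e + 1), H.coeff j ∈ J := by
    have h1 : H.eval 1 = aeval w F ^ q := by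
      rw [hH, eval_alongLine, ← aeval_pow_card]
      congr 2
      ext1 i
      simp only [δ]
      ring
    have h2 : H.eval 1 = ∑ j ∈ Finset.range (e + 1), H.coeff j := by
      rw [Polynomial.eval_eq_sum_range' (n := e + 1)
        (Nat.lt_succ_of_le (natDegree_alongLine_le hF w δ))]
      simp only [one_pow, mul_one]
      rfl
    rw [← h2, h1]
    exact Ideal.pow_mem_of_mem _ (Ideal.mem_span_singleton_self _) _ Nat.card_pos
  have hhigh : ∑ j ∈ (Finset.range (e + 1)).filter (k < ·), H.coeff j ∈ m ^ (k + 1) :=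
    sum_mem fun j hj => Ideal.pow_le_pow_right (Finset.mem_filter.1 hj).2 (hHm j)
  have hsplit : ∑ j ∈ Finset.range (e + 1), H.coeff j =
      ∑ j ∈ (Finset.range (e + 1)).filter (k < ·), H.coeff j +
        (H.coeff k + ∑ j ∈ Finset.range k, H.coeff j) := by
    rw [← Finset.sum_filter_add_sum_filter_not _ (k < ·), add_comm (H.coeff k),
      ← Finset.sum_range_succ]
    congr 2
    ext j
    simp only [Finset.mem_filter, Finset.mem_range]
    omega
  have hfin : c k = (∑ j ∈ Finset.range (e + 1), H.coeff j - ∑ j ∈ Finset.range k, H.coeff j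
      - (H.coeff k - c k)) - ∑ j ∈ (Finset.range (e + 1)).filter (k < ·), H.coeff j := by
    rw [hsplit]
    ring
  change c k ∈ J ⊔ m ^ (k + 1)
  rw [hfin]
  refine sub_mem (le_sup_left (a := J) ?_) (le_sup_right (a := J) hhigh)
  exact sub_mem (sub_mem hsum (sum_mem fun j hj => hlow j (Finset.mem_range.1 hj))) hmid

/-- Sziklai's bound for an irreducible curve of degree less than `q`. -/
theorem ncard_ratZeros_le_of_prime {F : MvPolynomial (Fin 3) K} {e : ℕ} (hF : F.IsHomogeneous e)
    (he : 1 ≤ e) (heq : e + 1 ≤ Nat.card K) (hp : Prime F) (hlin : HasNoLinearFactor F) :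
    (ratZeros K F).ncard ≤ (e - 1) * Nat.card K + 1 := by
  classical
  have hex : ∃ k, ¬ F ∣ frobCoeff F k := by
    obtain ⟨k, -, hk⟩ := exists_not_dvd_frobCoeff hF he (by omega) hp hlin
    exact ⟨k, hk⟩
  have hle : Nat.find hex ≤ e := by
    obtain ⟨k, hk, hk'⟩ := exists_not_dvd_frobCoeff hF he (by omega) hp hlin
    exact (Nat.find_min' hex hk').trans hk
  have hspec := Nat.find_spec hex
  have hmin : ∀ j < Nat.find hex, F ∣ frobCoeff F j := fun j hj => by
    simpa using Nat.find_min hex hj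
  set k := Nat.find hex
  -- The coefficients of index `0` and `e` are `F` and `F ^ q`, so `k` lies strictly between.
  have hk0 : k ≠ 0 := fun h0 => hspec (by rw [h0, frobCoeff_zero])
  have hke : k ≠ e := fun h0 => hspec (by
    rw [h0, frobCoeff_self hF]; exact dvd_pow_self _ Nat.card_pos.ne')
  have hb := mul_ncard_le_mul_of_coprime hF (isHomogeneous_frobCoeff hF k) hp hspec
    (subset_refl (ratZeros K F)) (k := k + 1)
    fun P _ a b => aeval_chart_frobCoeff_mem hF hle hmin P.rep a b
  generalize (ratZeros K F).ncard = N at hb ⊢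
  obtain ⟨u, rfl⟩ : ∃ u, e = k + 1 + u := ⟨e - (k + 1), by omega⟩
  obtain ⟨t, ht⟩ : ∃ t, Nat.card K = k + 1 + u + 1 + t := ⟨Nat.card K - (k + 1 + u + 1), by omega⟩
  rw [ht] at hb ⊢
  have e1 : k + 1 + u + 1 + t - 1 = k + 1 + u + t := by omega
  have e2 : k + 1 + u - 1 = k + u := by omega
  rw [e1] at hb
  rw [e2]
  refine Nat.le_of_mul_le_mul_left (hb.trans ?_) (Nat.succ_pos k)
  -- With `u = e - k - 1` and `t = q - e - 1`, the difference `(k + 1) * ((e - 1) * q + 1) - e * (e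
  -- + (q - 1) * k)` is exactly `u * t`.
  nlinarith [Nat.zero_le (u * t)]

end Frobenius

/-! ### Sziklai's bound below degree `q`, and irreducibility over `K` -/

section Reducible

variable {K : Type*} [Field K]

theorem ratZeros_mul {E : Type*} [Field E] [Algebra K E] (F G : MvPolynomial (Fin 3) E) :
    ratZeros K (F * G) = ratZeros K F ∪ ratZeros K G := by
  ext P
  simp [ratZeros]

theorem HasNoLinearFactor.of_dvd {F G : MvPolynomial (Fin 3) K} (h : HasNoLinearFactor F)
    (hG : G ∣ F) : HasNoLinearFactor G :=
  fun L hL0 hL hLG => h L hL0 hL (hLG.trans hG)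

theorem one_le_of_not_isUnit {σ : Type*} {F : MvPolynomial σ K} {e : ℕ} (hF : F.IsHomogeneous e)
    (hF0 : F ≠ 0) (hu : ¬ IsUnit F) : 1 ≤ e := by
  by_contra h
  obtain rfl : e = 0 := by omega
  rw [← totalDegree_zero_iff_isHomogeneous, totalDegree_eq_zero_iff_eq_C] at hF
  apply hu
  rw [hF]
  refine IsUnit.map C (Ne.isUnit fun h0 => hF0 ?_)
  rw [hF, h0, C_0]

theorem HasNoLinearFactor.two_le {F : MvPolynomial (Fin 3) K} {e : ℕ} (h : HasNoLinearFactor F)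
    (hF : F.IsHomogeneous e) (hF0 : F ≠ 0) (he : 1 ≤ e) : 2 ≤ e := by
  by_contra hc
  obtain rfl : e = 1 := by omega
  exact h F hF0 hF dvd_rfl

theorem not_isUnit_of_isHomogeneous {σ : Type*} {F : MvPolynomial σ K} {e : ℕ}
    (hF : F.IsHomogeneous e) (he : 1 ≤ e) : ¬ IsUnit F := by
  intro hu
  obtain ⟨c, -, hc⟩ := MvPolynomial.isUnit_iff_eq_C_of_isReduced.1 hu
  have h1 : F.IsHomogeneous 0 := hc ▸ isHomogeneous_C _ _
  have := h1.inj_right hF hu.ne_zero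
  omega

/-- A nontrivial factorization of a form without linear factors. -/
theorem exists_factors_of_not_irreducible {F : MvPolynomial (Fin 3) K} {e : ℕ}
    (hF : F.IsHomogeneous e) (hF0 : F ≠ 0) (he : 1 ≤ e) (hlin : HasNoLinearFactor F)
    (h : ¬ Irreducible F) :
    ∃ (A B : MvPolynomial (Fin 3) K) (a b : ℕ), F = A * B ∧ a + b = e ∧ 2 ≤ a ∧ 2 ≤ b ∧
      A.IsHomogeneous a ∧ B.IsHomogeneous b ∧ A ≠ 0 ∧ B ≠ 0 ∧ HasNoLinearFactor A ∧
      HasNoLinearFactor B := by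
  rw [irreducible_iff] at h
  push Not at h
  obtain ⟨A, B, hAB, hA, hB⟩ := h (not_isUnit_of_isHomogeneous hF he)
  obtain ⟨a, b, hab, hAa, hBb⟩ := exists_isHomogeneous_of_mul (hAB ▸ hF) (hAB ▸ hF0)
  have hA0 : A ≠ 0 := by rintro rfl; exact hF0 (by rw [hAB, zero_mul])
  have hB0 : B ≠ 0 := by rintro rfl; exact hF0 (by rw [hAB, mul_zero])
  have hAl := hlin.of_dvd (Dvd.intro _ hAB.symm)
  have hBl := hlin.of_dvd (Dvd.intro_left _ hAB.symm)
  exact ⟨A, B, a, b, hAB, hab, hAl.two_le hAa hA0 (one_le_of_not_isUnit hAa hA0 hA),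
    hBl.two_le hBb hB0 (one_le_of_not_isUnit hBb hB0 hB), hAa, hBb, hA0, hB0, hAl, hBl⟩

variable [Finite K]

/-- Sziklai's bound in degree less than `q`. -/
theorem ncard_ratZeros_le {e : ℕ} (heq : e + 1 ≤ Nat.card K) :
    ∀ {F : MvPolynomial (Fin 3) K}, F.IsHomogeneous e → F ≠ 0 → 1 ≤ e → HasNoLinearFactor F →
      (ratZeros K F).ncard ≤ (e - 1) * Nat.card K + 1 := by
  induction e using Nat.strong_induction_on with
  | _ e ih =>
    intro F hF hF0 he hlin
    by_cases hirr : Irreducible F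
    · exact ncard_ratZeros_le_of_prime hF he heq hirr.prime hlin
    · obtain ⟨A, B, a, b, rfl, hab, ha, hb, hA, hB, hA0, hB0, hAl, hBl⟩ :=
        exists_factors_of_not_irreducible hF hF0 he hlin hirr
      have h1 := ih a (by omega) (by omega) hA hA0 (by omega) hAl
      have h2 := ih b (by omega) (by omega) hB hB0 (by omega) hBl
      rw [ratZeros_mul]
      have h3 := Set.ncard_union_le (ratZeros K A) (ratZeros K B)
      obtain ⟨a, rfl⟩ : ∃ a', a = a' + 1 := ⟨a - 1, by omega⟩
      obtain ⟨b, rfl⟩ : ∃ b', b = b' + 1 := ⟨b - 1, by omega⟩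
      obtain rfl : e = a + b + 2 := by omega
      have hq : 1 ≤ Nat.card K := Nat.card_pos
      simp only [Nat.add_sub_cancel, show a + b + 2 - 1 = a + b + 1 by omega] at h1 h2 ⊢
      nlinarith

theorem degree_le_of_le_ncard {Z : Set (ℙ K (Fin 3 → K))} {d : ℕ}
    (hN : ((d : ℤ) - 2) * (Nat.card K : ℤ) + 3 ≤ (Z.ncard : ℤ)) : d ≤ Nat.card K + 2 := by
  have h1 : Z.ncard ≤ Nat.card K ^ 2 + Nat.card K + 1 := by
    rw [← card_plane, ← Set.ncard_univ]
    exact Set.ncard_le_ncard (Set.subset_univ _) (Set.toFinite _)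
  have h2 : (Z.ncard : ℤ) ≤ (Nat.card K : ℤ) ^ 2 + Nat.card K + 1 := by exact_mod_cast h1
  by_contra hc
  have h3 : (Nat.card K : ℤ) + 1 ≤ (d : ℤ) - 2 := by omega
  have hq : (0 : ℤ) < Nat.card K := by exact_mod_cast Nat.card_pos (α := K)
  nlinarith

/-- A curve without linear components and with many points is irreducible over the ground
field. -/
theorem irreducible_of_le_ncard {F : MvPolynomial (Fin 3) K} {d : ℕ} (hF : F.IsHomogeneous d)
    (hF0 : F ≠ 0) (hd : 1 ≤ d) (hlin : HasNoLinearFactor F)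
    (hN : ((d : ℤ) - 2) * (Nat.card K : ℤ) + 3 ≤ ((ratZeros K F).ncard : ℤ)) :
    Irreducible F := by
  by_contra hirr
  have hdq := degree_le_of_le_ncard hN
  obtain ⟨A, B, a, b, rfl, rfl, ha, hb, hA, hB, hA0, hB0, hAl, hBl⟩ :=
    exists_factors_of_not_irreducible hF hF0 hd hlin hirr
  rw [ratZeros_mul] at hN
  push_cast at hN
  by_cases hsmall : a + 1 ≤ Nat.card K ∧ b + 1 ≤ Nat.card K
  · have h1 := ncard_ratZeros_le hsmall.1 hA hA0 (by omega) hAl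
    have h2 := ncard_ratZeros_le hsmall.2 hB hB0 (by omega) hBl
    have h3 := Set.ncard_union_le (ratZeros K A) (ratZeros K B)
    zify [show 1 ≤ a by omega, show 1 ≤ b by omega] at h1 h2 h3
    linarith
  · have hcase : (a = Nat.card K ∧ b = 2) ∨ (a = 2 ∧ b = Nat.card K) := by omega
    have h4 : (ratZeros K A ∪ ratZeros K B).ncard ≤ Nat.card K ^ 2 + 2 := by
      rcases hcase with ⟨rfl, rfl⟩ | ⟨rfl, rfl⟩
      · exact ncard_union_conic_le hA hB hAl hBl
      · rw [Set.union_comm]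
        exact ncard_union_conic_le hB hA hBl hAl
    zify at h4
    have h5 : (a : ℤ) + b = Nat.card K + 2 := by omega
    rw [h5] at hN
    nlinarith

end Reducible

/-! ### Factors over an algebraic extension -/

section Descent

variable {K : Type*} [Field K] [Finite K] {E : Type*} [Field E] [Algebra K E]

/-- Finitely many algebraic elements generate a finite field, and `n` is its degree over `K`. -/
theorem exists_pow_card_pow_eq [Algebra.IsAlgebraic K E] (S : Finset E) :
    ∃ n, 1 ≤ n ∧ ∀ x ∈ S, x ^ (Nat.card K ^ n) = x := by
  have hfd : FiniteDimensional K (IntermediateField.adjoin K (S : Set E)) :=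
    IntermediateField.finiteDimensional_adjoin fun x _ => Algebra.IsIntegral.isIntegral x
  set L := IntermediateField.adjoin K (S : Set E)
  have : Finite L := Module.finite_of_finite K
  have : Fintype L := Fintype.ofFinite L
  refine ⟨Module.finrank K L, Module.finrank_pos, fun x hx => ?_⟩
  rw [← Module.natCard_eq_pow_finrank (K := K) (V := L), Nat.card_eq_fintype_card]
  have := FiniteField.pow_card (⟨x, IntermediateField.subset_adjoin K _ hx⟩ : L)
  exact congrArg Subtype.val this

/-- If a prime form over `K` splits over an algebraic extension, its rational zeros are zeros of
each of the factors. -/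
theorem eval_eq_zero_of_map_eq_mul [Algebra.IsAlgebraic K E] {σ : Type*} {F : MvPolynomial σ K}
    (hp : Prime F) {G H : MvPolynomial σ E} (hGH : MvPolynomial.map (algebraMap K E) F = G * H)
    (hG : ¬ IsUnit G) {v : σ → K} (hv : eval v F = 0) :
    aeval (fun i => algebraMap K E (v i)) G = 0 := by
  classical
  set q := Nat.card K with hq
  obtain ⟨f, hf⟩ := exists_frobenius (K := K) E
  have hf' : ∀ x, f x = x ^ q := hf
  let Φ : MvPolynomial σ E →+* MvPolynomial σ E := MvPolynomial.map (f : E →+* E)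
  have hcoeff : ∀ n p m, coeff m (Φ^[n] p) = coeff m p ^ q ^ n := by
    intro n
    induction n with
    | zero => intro p m; simp
    | succ n ih =>
      intro p m
      rw [Function.iterate_succ_apply', pow_succ, pow_mul, ← ih]
      simp only [Φ, coeff_map]
      exact hf _
  let u : σ → E := fun i => algebraMap K E (v i)
  have heval : ∀ n p, eval u (Φ^[n] p) = eval u p ^ q ^ n := by
    intro n
    induction n with
    | zero => intro p; simp
    | succ n ih =>
      intro p
      rw [Function.iterate_succ_apply', pow_succ, pow_mul, ← ih, ← hf']
      have hu : u = fun i => f (u i) := by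
        funext i
        exact (f.commutes _).symm
      conv_lhs => rw [hu]
      simp only [Φ]
      rw [eval_map]
      exact (eval₂_comp_left (f : E →+* E) (RingHom.id E) u _).symm
  have hfixed : ∀ p : MvPolynomial σ E, Φ p = p →
      ∃ p' : MvPolynomial σ K, MvPolynomial.map (algebraMap K E) p' = p := by
    intro p hpp
    have h : p ∈ Set.range (MvPolynomial.map (algebraMap K E)) := by
      rw [MvPolynomial.mem_range_map_iff_coeffs_subset]
      intro x hx
      obtain ⟨m, -, rfl⟩ := mem_coeffs_iff.1 hx
      have h1 := hcoeff 1 p m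
      rw [Function.iterate_one, hpp, pow_one] at h1
      obtain ⟨c, hc⟩ := exists_algebraMap_eq_of_pow_card_eq (K := K) h1.symm
      exact ⟨c, hc.symm⟩
    exact h
  -- All coefficients of `G` and `H` are fixed by the `n`-th power of Frobenius, so the product over
  -- one period is Frobenius-invariant and descends to `K`.
  obtain ⟨n, hn1, hn⟩ := exists_pow_card_pow_eq (K := K) (G.coeffs ∪ H.coeffs)
  have hper : ∀ p : MvPolynomial σ E, p.coeffs ⊆ G.coeffs ∪ H.coeffs → Φ^[n] p = p := by
    intro p hpc
    ext m
    rw [hcoeff]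
    by_cases h0 : coeff m p = 0
    · rw [h0, zero_pow (pow_ne_zero _ Nat.card_pos.ne')]
    · exact hn _ (hpc (coeff_mem_coeffs m h0))
  have hnorm : ∀ p : MvPolynomial σ E, p.coeffs ⊆ G.coeffs ∪ H.coeffs →
      ∃ p' : MvPolynomial σ K,
        MvPolynomial.map (algebraMap K E) p' = ∏ i ∈ Finset.range n, Φ^[i] p := by
    intro p hpc
    apply hfixed
    rw [map_prod]
    obtain ⟨k, rfl⟩ : ∃ k, n = k + 1 := ⟨n - 1, by omega⟩
    simp only [← Function.iterate_succ_apply' Φ]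
    rw [Finset.prod_range_succ, hper p hpc, Finset.prod_range_succ']
    rfl
  obtain ⟨G', hG'⟩ := hnorm G Finset.subset_union_left
  obtain ⟨H', hH'⟩ := hnorm H Finset.subset_union_right
  have hinj := MvPolynomial.map_injective (σ := σ) (algebraMap K E) (algebraMap K E).injective
  have hΦF : Φ (MvPolynomial.map (algebraMap K E) F) = MvPolynomial.map (algebraMap K E) F := by
    ext m
    simp only [Φ, coeff_map]
    exact f.commutes _
  have hprod : F ^ n = G' * H' := by
    apply hinj
    rw [map_mul, hG', hH', ← Finset.prod_mul_distrib, map_pow]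
    have h : ∀ i ∈ Finset.range n,
        Φ^[i] G * Φ^[i] H = MvPolynomial.map (algebraMap K E) F := fun i _ => by
      rw [← iterate_map_mul, ← hGH, Function.iterate_fixed hΦF]
    rw [Finset.prod_congr rfl h, Finset.prod_const, Finset.card_range]
  obtain ⟨i, -, hi⟩ := (dvd_prime_pow hp n).1 (Dvd.intro _ hprod.symm)
  have hi0 : i ≠ 0 := by
    rintro rfl
    rw [pow_zero] at hi
    apply hG
    have h1 : IsUnit (∏ i ∈ Finset.range n, Φ^[i] G) := by
      rw [← hG']
      exact (associated_one_iff_isUnit.1 hi).map _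
    exact isUnit_of_dvd_unit (Finset.dvd_prod_of_mem (fun i => Φ^[i] G)
      (Finset.mem_range.2 hn1)) h1
  have hdvd : F ∣ G' := (dvd_pow_self F hi0).trans hi.symm.dvd
  obtain ⟨c, hc⟩ := hdvd
  have h2 : eval u (MvPolynomial.map (algebraMap K E) G') = 0 := by
    have h3 : eval u (MvPolynomial.map (algebraMap K E) G') = algebraMap K E (eval v G') := by
      rw [eval_map]
      exact (eval₂_comp_left (algebraMap K E) (RingHom.id K) v _).symm
    rw [h3, hc, map_mul, hv, zero_mul, map_zero]
  rw [hG', map_prod, Finset.prod_eq_zero_iff] at h2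
  obtain ⟨j, -, hj⟩ := h2
  -- At a rational point, the value of a Frobenius conjugate of `G` is a power of the value of `G`
  -- itself.
  rw [heval] at hj
  exact pow_eq_zero_iff (pow_ne_zero _ Nat.card_pos.ne') |>.1 hj

/-- A nonzero form of degree at most `q` over an extension field has a nonzero rational value. -/
theorem exists_aeval_ne_zero {G : MvPolynomial (Fin 3) E} {e : ℕ} (hG : G.IsHomogeneous e)
    (he : e ≤ Nat.card K) (hG0 : G ≠ 0) :
    ∃ v : Fin 3 → K, aeval (fun i => algebraMap K E (v i)) G ≠ 0 := by
  classical
  obtain ⟨m, hm⟩ := ne_zero_iff.1 hG0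
  obtain ⟨π, hπ⟩ : ∃ π : Module.Dual K E, π (coeff m G) ≠ 0 := by
    by_contra! h
    exact hm ((Module.forall_dual_apply_eq_zero_iff K _).1 h)
  -- Applying a `K`-linear functional to the coefficients commutes with evaluation at rational
  -- vectors, which reduces the claim to a nonzero form over `K`.
  let P : MvPolynomial (Fin 3) K := ∑ d ∈ G.support, monomial d (π (coeff d G))
  have hPh : P.IsHomogeneous e := IsHomogeneous.sum _ _ _ fun d hd =>
    isHomogeneous_monomial _ ((hG.degree_eq_sum_deg_support hd).symm)
  have hP0 : P ≠ 0 := by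
    rw [ne_zero_iff]
    refine ⟨m, ?_⟩
    simp only [P, coeff_sum, coeff_monomial]
    rw [Finset.sum_ite_eq' G.support m, if_pos (mem_support_iff.2 hm)]
    exact hπ
  obtain ⟨v, hv⟩ := exists_eval_ne_zero hPh he hP0
  refine ⟨v, fun h0 => hv ?_⟩
  have h1 : π (aeval (fun i => algebraMap K E (v i)) G) = eval v P := by
    rw [aeval_def, eval₂_eq, map_sum, map_sum]
    refine Finset.sum_congr rfl fun d _ => ?_
    rw [eval_monomial, Finsupp.prod]
    have h2 : (algebraMap E E) (coeff d G) * ∏ i ∈ d.support, algebraMap K E (v i) ^ d i =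
        (∏ i ∈ d.support, v i ^ d i) • coeff d G := by
      rw [Algebra.smul_def, map_prod]
      simp [mul_comm]
    rw [h2, map_smul, smul_eq_mul, mul_comm]
  rw [← h1, h0, map_zero]

/-- An irreducible curve without linear components and with many points does not split over an
algebraic extension. -/
theorem not_isUnit_factor_aux [Algebra.IsAlgebraic K E] {F : MvPolynomial (Fin 3) K} {d : ℕ}
    (hF : F.IsHomogeneous d) (hp : Prime F) (hlin : HasNoLinearFactor F)
    (hN : ((d : ℤ) - 2) * (Nat.card K : ℤ) + 3 ≤ ((ratZeros K F).ncard : ℤ))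
    {G H : MvPolynomial (Fin 3) E} (hGH : MvPolynomial.map (algebraMap K E) F = G * H)
    {g h : ℕ} (hG : G.IsHomogeneous g) (hG0 : G ≠ 0) (hg : 1 ≤ g) (hgh : g ≤ h)
    (hd : g + h = d) : False := by
  have hdq := degree_le_of_le_ncard hN
  have hq1 : 1 < Nat.card K := Finite.one_lt_card
  have hsub : ratZeros K F ⊆ ratZeros K G := fun P hP =>
    eval_eq_zero_of_map_eq_mul hp hGH (not_isUnit_of_isHomogeneous hG hg) (v := P.rep) hP
  rcases Nat.lt_or_ge g 2 with hg2 | hg2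
  · obtain rfl : g = 1 := by omega
    have h2 : 1 < (ratZeros K F).ncard := by
      have : (0 : ℤ) ≤ ((d : ℤ) - 2) * (Nat.card K : ℤ) :=
        mul_nonneg (by omega) (by omega)
      omega
    obtain ⟨P, Q, hP, hQ, hPQ⟩ := (Set.one_lt_ncard_iff (Set.toFinite _)).1 h2
    refine alongLine_ne_zero hF hlin (linearIndependent_rep hPQ) ?_
    apply Polynomial.map_injective (algebraMap K E) (algebraMap K E).injective
    have h3 : alongLine F (fun i => algebraMap K E (Q.rep i)) (fun i => algebraMap K E (P.rep i)) =
        (alongLine F Q.rep P.rep).map (algebraMap K E) :=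
      alongLine_map (Algebra.ofId K E) F Q.rep P.rep
    have h4 : alongLine F (fun i => algebraMap K E (Q.rep i)) (fun i => algebraMap K E (P.rep i)) =
        alongLine G (fun i => algebraMap K E (Q.rep i)) (fun i => algebraMap K E (P.rep i)) *
        alongLine H (fun i => algebraMap K E (Q.rep i)) (fun i => algebraMap K E (P.rep i)) := by
      simp only [alongLine]
      rw [← map_mul, ← hGH, aeval_map_algebraMap]
    have h5 : alongLine G (fun i => algebraMap K E (Q.rep i))
        (fun i => algebraMap K E (P.rep i)) = 0 := by
      ext j
      rcases j with _ | _ | j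
      · rw [coeff_alongLine_zero]
        exact hsub hQ
      · rw [coeff_alongLine_self hG]
        exact hsub hP
      · exact coeff_alongLine_eq_zero hG _ _ (by omega)
    rw [← h3, h4, h5, zero_mul, Polynomial.map_zero]
  -- Here `2 * g ≤ d ≤ q + 2` and `q ≥ 2` give `g ≤ q`, so some rational point lies off `G`.
  · obtain ⟨v, hv⟩ := exists_aeval_ne_zero (K := K) hG (by omega) hG0
    have hv0 : v ≠ 0 := by
      rintro rfl
      apply hv
      have := aeval_mul_of_isHomogeneous hG (0 : Fin 3 → E) 0
      rw [zero_pow (by omega), zero_mul] at this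
      simpa using this
    have hP : Projectivization.mk K v hv0 ∉ ratZeros K G := by
      rwa [mk_mem_ratZeros hG hv0]
    have h1 := ncard_diff_singleton_le (Z := ratZeros K G) (P := Projectivization.mk K v hv0)
      fun l hl => ncard_line_le_of_notMem hG hl hP
    rw [Set.sdiff_singleton_eq_self hP] at h1
    have h2 := (Set.ncard_le_ncard hsub (Set.toFinite _)).trans h1
    zify at h2
    -- Together, `h3` and `h4` express `(d - 2) * q + 3 - (q + 1) * g` as 1 plus two nonnegative
    -- terms.
    have h3 : (0 : ℤ) ≤ ((g : ℤ) - 2) * ((Nat.card K : ℤ) - 1) :=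
      mul_nonneg (by omega) (by omega)
    have h4 : (0 : ℤ) ≤ ((d : ℤ) - 2 * g) * (Nat.card K : ℤ) :=
      mul_nonneg (by omega) (by omega)
    nlinarith

end Descent

/-! ### Absolute irreducibility -/

theorem corollary2p2 {K : Type*} [Field K] [Finite K] (q : ℕ) (hq : Nat.card K = q)
    (d : ℕ) (C : ProjPlaneCurve K d) (hlin : ¬ C.HasLinearComponent)
    (hN : ((d : ℤ) - 2) * (q : ℤ) + 3 ≤ (C.numPoints : ℤ)) :
    C.AbsolutelyIrreducible := by
  subst hq
  have hl : HasNoLinearFactor C.form := fun L hL0 hL hd => hlin ⟨L, hL0, hL, hd⟩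
  have hNZ : ((d : ℤ) - 2) * (Nat.card K : ℤ) + 3 ≤ ((ratZeros K C.form).ncard : ℤ) := hN
  have hirr := irreducible_of_le_ncard C.isHomogeneous C.form_ne_zero C.degree_pos hl hNZ
  set F' := MvPolynomial.map (algebraMap K (AlgebraicClosure K)) C.form with hF'
  have hF'h : F'.IsHomogeneous d := C.isHomogeneous.map _
  have hF'0 : F' ≠ 0 := fun h0 => C.form_ne_zero
    (MvPolynomial.map_injective _ (algebraMap K (AlgebraicClosure K)).injective
      (by rw [← hF', h0, map_zero]))
  refine irreducible_iff.2 ⟨not_isUnit_of_isHomogeneous hF'h C.degree_pos, fun G H hGH => ?_⟩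
  by_contra! hc
  change F' = G * H at hGH
  obtain ⟨g, h, hgh, hG, hH⟩ := exists_isHomogeneous_of_mul (hGH ▸ hF'h) (hGH ▸ hF'0)
  have hG0 : G ≠ 0 := by rintro rfl; exact hF'0 (by rw [hGH, zero_mul])
  have hH0 : H ≠ 0 := by rintro rfl; exact hF'0 (by rw [hGH, mul_zero])
  have hg := one_le_of_not_isUnit hG hG0 hc.1
  have hh := one_le_of_not_isUnit hH hH0 hc.2
  rcases le_total g h with hle | hle
  · exact not_isUnit_factor_aux C.isHomogeneous hirr.prime hl hNZ hGH hG hG0 hg hle hgh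
  · exact not_isUnit_factor_aux C.isHomogeneous hirr.prime hl hNZ
      (hGH.trans (mul_comm _ _)) hH hH0 hh hle (by omega)
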